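/- Let $\mathbb K=\mathbb R$ or $\mathbb C$. For a Banach space $X$ over $\mathbb K$ let $\mathcal K(X)$ be the space of compact operators $X\to X$ with the operator norm, let $\mathcal A(X)\subset\mathcal K(X)$ be the operator-norm closure of the bounded finite rank operators, and let $\mathfrak A_X=\mathcal K(X)/\mathcal A(X)$ carry the quotient norm. For normed spaces $E,F$ let $d_{BM}(E,F)=\inf\{\|T\|\,\|T^{-1}\| : T\colon E\to F \text{ a linear isomorphism}\}$ be the Banach–Mazur distance ($\infty$ if there is no such $T$). Let $(E_n)_{n\in\mathbb N}$ be a sequence of finite-dimensional normed spaces over $\mathbb K$ that is dense in the Banach–Mazur distance in the class of all finite-dimensional normed spaces, that is, for every non-zero finite-dimensional normed space $F$ over $\mathbb K$ and every $c>1$ there is $n$ with $d_{BM}(E_n,F)<c$. Let $(G_m)_{m\in\mathbb N}$ be a listing of the spaces $E_n$ in which each $E_n$ is repeated infinitely often, that is, $G_m=E_{\sigma(m)}$ where $\sigma\colon\mathbb N\to\mathbb N$ takes every value infinitely often. Let $C_1=\big(\bigoplus_{m\in\mathbb N}G_m\big)_{\ell^1}$ be Johnson's space and $C_1^*$ its dual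 space. Then $\mathfrak A_{C_1^*}$ contains a closed linear subspace that is linearly isomorphic (linearly homeomorphic) to the sequence space $c_0$, whereas $\mathfrak A_{C_1}=\{0\}$. -/

import Mathlib

open scoped ENNReal ZeroAtInfty

noncomputable section

universe u v w

/-- The linear subspace of bounded finite rank operators `X → Y`. -/
def finiteRankOperators (𝕜 : Type u) [RCLike 𝕜] (X : Type v) (Y : Type w)
    [NormedAddCommGroup X] [NormedSpace 𝕜 X] [NormedAddCommGroup Y] [NormedSpace 𝕜 Y] :
    Submodule 𝕜 (X →L[𝕜] Y) :=
  (LinearMap.finiteRange 𝕜 X Y).comap (ContinuousLinearMap.coeLM 𝕜)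

/-- The approximable operators `𝒜(X, Y)`: the operator norm closure of the bounded finite rank
operators. -/
def approximableOperators (𝕜 : Type u) [RCLike 𝕜] (X : Type v) (Y : Type w)
    [NormedAddCommGroup X] [NormedSpace 𝕜 X] [NormedAddCommGroup Y] [NormedSpace 𝕜 Y] :
    Submodule 𝕜 (X →L[𝕜] Y) :=
  (finiteRankOperators 𝕜 X Y).topologicalClosure

/-- The compact operators `𝒦(X)`, with the operator norm. -/
abbrev CompactOperators (𝕜 : Type u) [RCLike 𝕜] (X : Type v)
    [NormedAddCommGroup X] [NormedSpace 𝕜 X] : Submodule 𝕜 (X →L[𝕜] X) :=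
  compactOperator (RingHom.id 𝕜) X X

/-- `𝒜(X)` as a subspace of `𝒦(X)`. -/
abbrev approximableInCompact (𝕜 : Type u) [RCLike 𝕜] (X : Type v)
    [NormedAddCommGroup X] [NormedSpace 𝕜 X] : Submodule 𝕜 (CompactOperators 𝕜 X) :=
  (approximableOperators 𝕜 X X).submoduleOf (CompactOperators 𝕜 X)

instance isClosed_approximableInCompact (𝕜 : Type u) [RCLike 𝕜] (X : Type v)
    [NormedAddCommGroup X] [NormedSpace 𝕜 X] :
    IsClosed (approximableInCompact 𝕜 X : Set (CompactOperators 𝕜 X)) :=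
  (Submodule.isClosed_topologicalClosure (finiteRankOperators 𝕜 X X)).preimage
    continuous_subtype_val

/-- The quotient `𝒦(X) / 𝒜(X)`, with the quotient norm `‖T + 𝒜(X)‖ = dist(T, 𝒜(X))`. -/
abbrev CompactByApproximable (𝕜 : Type u) [RCLike 𝕜] (X : Type v)
    [NormedAddCommGroup X] [NormedSpace 𝕜 X] : Type v :=
  CompactOperators 𝕜 X ⧸ approximableInCompact 𝕜 X

/-- The Banach-Mazur distance, the infimum of `‖T‖ ‖T⁻¹‖` over the linear isomorphisms
`T : E → F`; it is `∞` if there are none. -/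
def banachMazurDist (𝕜 : Type u) [RCLike 𝕜] (E : Type v) (F : Type w)
    [NormedAddCommGroup E] [NormedSpace 𝕜 E] [NormedAddCommGroup F] [NormedSpace 𝕜 F] : ℝ≥0∞ :=
  ⨅ T : E ≃L[𝕜] F, ENNReal.ofReal (‖(T : E →L[𝕜] F)‖ * ‖(T.symm : F →L[𝕜] E)‖)

/-- The sequence `(E n)` is dense, in the Banach-Mazur distance, in the class of all
finite-dimensional normed spaces. The zero space is allowed among the `E n` but not required.
Every finite-dimensional normed space is isometric to some norm on a power `𝕜ᵏ`, so letting `F`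
range over the universe of `𝕜` loses nothing. -/
def BanachMazurDense (𝕜 : Type u) [RCLike 𝕜] (E : ℕ → Type v)
    [∀ n, NormedAddCommGroup (E n)] [∀ n, NormedSpace 𝕜 (E n)] : Prop :=
  ∀ (F : Type u) [NormedAddCommGroup F] [NormedSpace 𝕜 F] [FiniteDimensional 𝕜 F] [Nontrivial F]
    (c : ℝ≥0∞), 1 < c → ∃ n, banachMazurDist 𝕜 (E n) F < c

/-- `X` contains a linear isomorphic copy of the sequence space `c₀`: some closed linear subspace
of `X` is linearly homeomorphic to `c₀`. -/
def ContainsCopyOfC0 (𝕜 : Type u) [RCLike 𝕜] (X : Type v)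
    [NormedAddCommGroup X] [NormedSpace 𝕜 X] : Prop :=
  ∃ W : Submodule 𝕜 X, IsClosed (W : Set X) ∧ Nonempty (C₀(ℕ, 𝕜) ≃L[𝕜] W)

/-- Johnson's space `C₁`: the `ℓ¹`-direct sum of the listing `m ↦ E (σ m)`. -/
abbrev JohnsonC1 (E : ℕ → Type v) [∀ n, NormedAddCommGroup (E n)] (σ : ℕ → ℕ) : Type v :=
  lp (fun m => E (σ m)) 1

end

noncomputable section

universe u v w

open scoped NNReal ComplexConjugate
open Filter Topology

/-! ### Sign matrices -/

/-! On `C₁` the coordinate truncations are contractions of finite rank that converge pointwise to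
the identity, hence uniformly on compact sets. So every compact operator is approximable
(`IsCompactOperator.mem_approximableOperators_lp_one`).

For the dual, the core is a compact, non-approximable operator between dual spaces, detected by an
Enflo-type trace argument. The spaces `CoefSpace 𝕜 s` consist of the same finitely supported
coefficients, normed by a supremum over the rows of sign matrices, with weight (1 + s)^l at level l.
A row of level k involves the coefficients of levels k and k + 1. Columns are orthogonal, so a
coefficient functional of level k + 1 is a signed average of the rows of level k + 1, and also of
those of level k. Therefore consecutive values of `levelTrace` differ by an average of pairings with
the vectors `rowDiff`. In such a vector the large value at its own row cancels, and near
orthogonality of distinct rows makes the remaining values of order (15/16)^k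
(`CoefSpace.norm_rowDiff_le`). A weight slightly above 1 keeps these increments summable, so
`levelTrace` is bounded uniformly in the level (`CoefSpace.norm_levelTrace_le`). It tends to 0 on
finite rank operators, hence on approximable ones
(`CoefSpace.tendsto_levelTrace_of_mem_approximableOperators`). The adjoint `unweightDual` of the
identity from weighted to unweighted coefficients has all level traces equal to 1, yet the weights
make it compact (`CoefSpace.isCompactOperator_unweightDual`).

Both coefficient spaces are increasing unions of finite-dimensional subspaces. These occur among the
summands of `C₁` infinitely often, disjointly and up to uniform isomorphism, and an ultrafilter
limit turns them into a sequence of disjoint, uniformly complemented copies of the dual inside `C₁*`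
(`exists_disjoint_complemented_duals`). Project `C₁*` onto one unweighted copy, apply
`unweightDual`, and spread the result over the weighted copies with coefficients a in `c₀`.
Compression to the l-th copy returns `a l` times `unweightDual`, so the traces bound the distance to
the approximable operators below by a multiple of the norm of a. -/

/-- The four-dimensional vector space over the field with two elements. -/
abbrev BitVec4 : Type := Fin 4 → ZMod 2

/-- The nontrivial real character of `ZMod 2`. -/
def bitSign (a : ZMod 2) : ℝ := if a = 0 then 1 else -1

lemma bitSign_zero : bitSign 0 = 1 := by simp [bitSign]

lemma bitSign_add (a b : ZMod 2) : bitSign (a + b) = bitSign a * bitSign b := by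
  have h : ∀ a b : ZMod 2, (a + b = 0 ↔ (a = 0 ↔ b = 0)) := by decide
  unfold bitSign
  by_cases ha : a = 0 <;> by_cases hb : b = 0 <;> simp [h, ha, hb]

lemma bitSign_mul_self (a : ZMod 2) : bitSign a * bitSign a = 1 := by
  unfold bitSign; split_ifs <;> norm_num

lemma abs_bitSign (a : ZMod 2) : |bitSign a| = 1 := by
  unfold bitSign; split_ifs <;> norm_num

/-- The quadratic form without diagonal terms on `BitVec4` with coefficients `c`. -/
def quadForm (c : Fin 6 → ZMod 2) (v : BitVec4) : ZMod 2 :=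
  c 0 * (v 0 * v 1) + c 1 * (v 2 * v 3) + c 2 * (v 0 * v 2) + c 3 * (v 0 * v 3) +
    c 4 * (v 1 * v 2) + c 5 * (v 1 * v 3)

lemma quadForm_add (c d : Fin 6 → ZMod 2) (v : BitVec4) :
    quadForm (c + d) v = quadForm c v + quadForm d v := by
  simp only [quadForm, Pi.add_apply]; ring

/-- The Hadamard matrix whose rows are the characters of `BitVec4` multiplied by the sign of a
quadratic form. -/
def hadamard (c : Fin 6 → ZMod 2) (x y : BitVec4) : ℝ := bitSign (x ⬝ᵥ y + quadForm c y)

lemma abs_hadamard (c : Fin 6 → ZMod 2) (x y : BitVec4) : |hadamard c x y| = 1 := abs_bitSign _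

lemma sum_bitSign_dotProduct (x : BitVec4) :
    ∑ y : BitVec4, bitSign (x ⬝ᵥ y) = if x = 0 then 16 else 0 := by
  split_ifs with hx
  · subst hx
    simp [bitSign_zero]
  · obtain ⟨i, hi⟩ : ∃ i, x i ≠ 0 := by
      by_contra! h
      exact hx (funext h)
    have h1 : x i = 1 := by
      have : ∀ a : ZMod 2, a ≠ 0 → a = 1 := by decide
      exact this _ hi
    have key : ∑ y : BitVec4, bitSign (x ⬝ᵥ y) = ∑ y : BitVec4, -bitSign (x ⬝ᵥ y) := by
      -- Translation by the i-th unit vector flips every sign because `x i = 1`.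
      rw [← Equiv.sum_comp (Equiv.addRight (Pi.single i (1 : ZMod 2)))]
      refine Finset.sum_congr rfl fun y _ => ?_
      rw [Equiv.coe_addRight, dotProduct_add, dotProduct_single, h1, bitSign_add]
      simp [bitSign]
    rw [Finset.sum_neg_distrib] at key
    linarith

lemma sum_hadamard_rows (c : Fin 6 → ZMod 2) (x x' : BitVec4) :
    ∑ y, hadamard c x y * hadamard c x' y = if x = x' then 16 else 0 := by
  have h2 : ∀ a b : ZMod 2, a + b = 0 ↔ a = b := by decide
  have h3 : ∀ a b c : ZMod 2, (a + c) + (b + c) = a + b := by decide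
  have : x = x' ↔ x + x' = 0 := by
    simp only [funext_iff, Pi.add_apply, Pi.zero_apply, h2]
  simp only [this, ← sum_bitSign_dotProduct]
  refine Finset.sum_congr rfl fun y _ => ?_
  rw [hadamard, hadamard, ← bitSign_add, h3, add_dotProduct]

lemma sum_hadamard_cols (c : Fin 6 → ZMod 2) (y y' : BitVec4) :
    ∑ x, hadamard c x y * hadamard c x y' = if y = y' then 16 else 0 := by
  have h2 : ∀ a b : ZMod 2, a + b = 0 ↔ a = b := by decide
  have : y = y' ↔ y + y' = 0 := by
    simp only [funext_iff, Pi.add_apply, Pi.zero_apply, h2]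
  have h : ∑ x, hadamard c x y * hadamard c x y' =
      bitSign (quadForm c y + quadForm c y') * ∑ x, bitSign ((y + y') ⬝ᵥ x) := by
    rw [Finset.mul_sum]
    refine Finset.sum_congr rfl fun x _ => ?_
    rw [hadamard, hadamard, ← bitSign_add, ← bitSign_add, add_dotProduct, dotProduct_comm y,
      dotProduct_comm y']
    congr 1; ring
  rw [h, sum_bitSign_dotProduct]
  by_cases hy : y = y'
  · subst hy
    rw [if_pos (this.1 rfl), if_pos rfl, (h2 _ _).2 rfl, bitSign_zero, one_mul]
  · rw [if_neg hy, if_neg fun h => hy (this.2 h), mul_zero]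

/-- A sum of an affine function and a nonzero quadratic form without diagonal terms is not
constant. -/
lemma quadForm_eq_zero_of_forall_eq (c : Fin 6 → ZMod 2) (x : BitVec4)
    (h : ∀ y y' : BitVec4, x ⬝ᵥ y + quadForm c y = x ⬝ᵥ y' + quadForm c y') : c = 0 := by
  have h0 : ∀ y : BitVec4, x ⬝ᵥ y + quadForm c y = 0 := fun y => by
    rw [h y 0]; simp [quadForm]
  -- The quadratic form equals a linear function, so it is additive. On pairs of unit vectors
  -- additivity reads off its six coefficients one by one.
  have key : ∀ y z : BitVec4, quadForm c (y + z) = quadForm c y + quadForm c z := fun y z => by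
    have h1 := h0 (y + z)
    rw [dotProduct_add] at h1
    linear_combination h1 - h0 y - h0 z
  have h01 := key ![1, 0, 0, 0] ![0, 1, 0, 0]
  have h23 := key ![0, 0, 1, 0] ![0, 0, 0, 1]
  have h02 := key ![1, 0, 0, 0] ![0, 0, 1, 0]
  have h03 := key ![1, 0, 0, 0] ![0, 0, 0, 1]
  have h12 := key ![0, 1, 0, 0] ![0, 0, 1, 0]
  have h13 := key ![0, 1, 0, 0] ![0, 0, 0, 1]
  simp [quadForm] at h01 h23 h02 h03 h12 h13
  ext i
  fin_cases i <;> simp [*]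

/-- Two terms of opposite sign cancel. Any bound strictly below the cardinality would serve. -/
lemma abs_sum_le_of_not_forall_eq {ι : Type*} [Fintype ι] (f : ι → ZMod 2)
    (h : ¬ ∀ y y', f y = f y') : |∑ y, bitSign (f y)| ≤ Fintype.card ι - 1 := by
  classical
  push Not at h
  obtain ⟨y, y', hyy⟩ := h
  have hne : y ≠ y' := fun e => hyy (by rw [e])
  have hval : ∀ a b : ZMod 2, a ≠ b → bitSign a + bitSign b = 0 := by
    intro a b hab
    have : ∀ a b : ZMod 2, a ≠ b → (a = 0 ∧ b ≠ 0) ∨ (a ≠ 0 ∧ b = 0) := by decide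
    rcases this a b hab with ⟨h1, h2⟩ | ⟨h1, h2⟩ <;> simp [bitSign, h1, h2]
  have hs : ∑ z, bitSign (f z) = ∑ z ∈ Finset.univ \ {y, y'}, bitSign (f z) := by
    rw [← Finset.sum_sdiff (Finset.subset_univ {y, y'}), Finset.sum_pair hne, hval _ _ hyy,
      add_zero]
  rw [hs]
  calc |∑ z ∈ Finset.univ \ {y, y'}, bitSign (f z)|
      ≤ ∑ z ∈ Finset.univ \ {y, y'}, |bitSign (f z)| := Finset.abs_sum_le_sum_abs _ _
    _ = ((Finset.univ \ {y, y'} : Finset ι).card : ℝ) := by simp [abs_bitSign]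
    _ ≤ Fintype.card ι - 1 := by
      have hc := Finset.card_sdiff_add_card_eq_card (Finset.subset_univ {y, y'})
      rw [Finset.card_pair hne, Finset.card_univ] at hc
      have : (((Finset.univ \ {y, y'} : Finset ι).card : ℝ)) + 2 = Fintype.card ι := by
        exact_mod_cast hc
      linarith

/-- The product of the two rows is the sign of a linear function plus the form with coefficients `c
+ d`, which is nonzero and so makes the sign non-constant. The gain from 16 to 15 in each factor is
the source of the decay (15/16)^k. -/
lemma abs_sum_hadamard_le {c d : Fin 6 → ZMod 2} (hcd : c ≠ d) (x x' : BitVec4) :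
    |∑ y, hadamard c x y * hadamard d x' y| ≤ 15 := by
  have h2 : ∀ a b : ZMod 2, a + b = 0 → a = b := by decide
  have h : ∀ y, hadamard c x y * hadamard d x' y =
      bitSign ((x + x') ⬝ᵥ y + quadForm (c + d) y) := fun y => by
    rw [hadamard, hadamard, ← bitSign_add, quadForm_add, add_dotProduct]
    congr 1; ring
  simp only [h]
  refine (abs_sum_le_of_not_forall_eq _ fun hc => hcd ?_).trans (by norm_num)
  have := quadForm_eq_zero_of_forall_eq _ _ hc
  exact funext fun i => h2 _ _ (congrFun this i)

/-- The coefficients of the quadratic forms used to separate the rows of the sign matrices. -/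
def rowCode (t : ZMod 2) : Option BitVec4 → Fin 6 → ZMod 2
  | none => ![t, 0, 0, 0, 0, 0]
  | some b => ![t, 1, b 0, b 1, b 2, b 3]

/-- The second coefficient marks whether a code belongs to an upper or a lower matrix. One bit for
`t`, one marker and four bits for `b` use up the six monomials available in dimension four. -/
lemma rowCode_none_ne_some (t t' : ZMod 2) (b : BitVec4) :
    rowCode t none ≠ rowCode t' (some b) := fun h => by
  simpa [rowCode] using congrFun h 1

lemma rowCode_some_injective {t t' : ZMod 2} {b b' : BitVec4}
    (h : rowCode t (some b) = rowCode t' (some b')) : b = b' ∧ t = t' := by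
  have h0 := congrFun h 0
  have h2 := congrFun h 2
  have h3 := congrFun h 3
  have h4 := congrFun h 4
  have h5 := congrFun h 5
  simp [rowCode] at h0 h2 h3 h4 h5
  refine ⟨funext fun i => ?_, h0⟩
  fin_cases i <;> simp [*]

lemma rowCode_none_injective {t t' : ZMod 2} (h : rowCode t none = rowCode t' none) : t = t' := by
  simpa [rowCode] using congrFun h 0

/-- The columns of the sign matrices of level `k`. -/
abbrev SignCol (k : ℕ) : Type := Fin k → BitVec4

/-- The rows of the sign matrices of level `k`. -/
abbrev SignRow (k : ℕ) : Type := SignCol k × BitVec4 × ZMod 2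

/-- The sign matrix linking the points of level `k` to the coefficients of level `k`. -/
def lowerSign (k : ℕ) (g : SignRow k) (y : SignCol k) : ℝ :=
  bitSign g.2.2 * ∏ i, hadamard (rowCode g.2.2 (some g.2.1)) (g.1 i) (y i)

/-- The sign matrix linking the points of level `k` to the coefficients of level `k + 1`. -/
def upperSign (k : ℕ) (g : SignRow k) (y : SignCol (k + 1)) : ℝ :=
  hadamard (rowCode 0 none) g.2.1 (y 0) *
    ∏ i : Fin k, hadamard (rowCode g.2.2 none) (g.1 i) (y i.succ)

lemma sum_pi_prod {ι : Type*} [Fintype ι] [DecidableEq ι] {κ : Type*} [Fintype κ]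
    (f : ι → κ → ℝ) : ∑ y : ι → κ, ∏ i, f i (y i) = ∏ i, ∑ z, f i z := by
  classical
  rw [Finset.prod_univ_sum, Fintype.piFinset_univ]

lemma sum_cons_prod {κ : Type*} [Fintype κ] (k : ℕ) (f : κ → ℝ) (h : Fin k → κ → ℝ) :
    ∑ y : Fin (k + 1) → κ, f (y 0) * ∏ i : Fin k, h i (y i.succ) =
      (∑ z, f z) * ∏ i, ∑ z, h i z := by
  have := sum_pi_prod (fun i : Fin (k + 1) => (Fin.cons f h : Fin (k + 1) → κ → ℝ) i)
  simpa [Fin.prod_univ_succ] using this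

lemma abs_lowerSign (k : ℕ) (g : SignRow k) (y : SignCol k) : |lowerSign k g y| = 1 := by
  simp [lowerSign, abs_mul, Finset.abs_prod, abs_bitSign, abs_hadamard]

lemma abs_upperSign (k : ℕ) (g : SignRow k) (y : SignCol (k + 1)) : |upperSign k g y| = 1 := by
  simp [upperSign, abs_mul, Finset.abs_prod, abs_hadamard]

lemma prod_ite_eq_funext {k : ℕ} (a b : Fin k → BitVec4) (r : ℝ) :
    ∏ i, (if a i = b i then r else 0) = if a = b then r ^ k else 0 := by
  split_ifs with h
  · subst h; simp
  · obtain ⟨i, hi⟩ := Function.ne_iff.1 h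
    exact Finset.prod_eq_zero (Finset.mem_univ i) (if_neg hi)

lemma sum_lowerSign_cols (k : ℕ) (y y' : SignCol k) :
    ∑ g, lowerSign k g y * lowerSign k g y' = if y = y' then 32 * 16 ^ k else 0 := by
  have h : ∀ (b : BitVec4) (t : ZMod 2),
      ∑ x : SignCol k, lowerSign k (x, b, t) y * lowerSign k (x, b, t) y' =
        if y = y' then 16 ^ k else 0 := fun b t => by
    have : ∀ x : SignCol k, lowerSign k (x, b, t) y * lowerSign k (x, b, t) y' =
        ∏ i, hadamard (rowCode t (some b)) (x i) (y i) *
          hadamard (rowCode t (some b)) (x i) (y' i) := fun x => by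
      rw [Finset.prod_mul_distrib, lowerSign, lowerSign]
      linear_combination (bitSign_mul_self t) *
        (∏ i, hadamard (rowCode t (some b)) (x i) (y i)) *
          ∏ i, hadamard (rowCode t (some b)) (x i) (y' i)
    simp only [this]
    rw [sum_pi_prod (fun i z => hadamard (rowCode t (some b)) z (y i) *
          hadamard (rowCode t (some b)) z (y' i))]
    simp only [sum_hadamard_cols]
    exact prod_ite_eq_funext y y' 16
  rw [Fintype.sum_prod_type_right]
  simp only [h]
  split_ifs <;> simp

/-- Summing over the first component of the row separates the tails of the columns, and summing over
`b` separates their heads; `t` only contributes a factor 2. -/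
lemma sum_upperSign_cols (k : ℕ) (y y' : SignCol (k + 1)) :
    ∑ g, upperSign k g y * upperSign k g y' = if y = y' then 32 * 16 ^ k else 0 := by
  have h : ∀ (b : BitVec4) (t : ZMod 2),
      ∑ x : SignCol k, upperSign k (x, b, t) y * upperSign k (x, b, t) y' =
        hadamard (rowCode 0 none) b (y 0) * hadamard (rowCode 0 none) b (y' 0) *
        if Fin.tail y = Fin.tail y' then 16 ^ k else 0 := fun b t => by
    have : ∀ x : SignCol k, upperSign k (x, b, t) y * upperSign k (x, b, t) y' =
        hadamard (rowCode 0 none) b (y 0) * hadamard (rowCode 0 none) b (y' 0) *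
        ∏ i, hadamard (rowCode t none) (x i) (Fin.tail y i) *
          hadamard (rowCode t none) (x i) (Fin.tail y' i) := fun x => by
      rw [Finset.prod_mul_distrib, upperSign, upperSign]
      simp only [Fin.tail]
      ring
    simp only [this]
    rw [← Finset.mul_sum, sum_pi_prod (fun i z => hadamard (rowCode t none) z (Fin.tail y i) *
          hadamard (rowCode t none) z (Fin.tail y' i))]
    simp only [sum_hadamard_cols]
    rw [prod_ite_eq_funext (Fin.tail y) (Fin.tail y') 16]
  have hy : y = y' ↔ y 0 = y' 0 ∧ Fin.tail y = Fin.tail y' := by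
    refine ⟨fun h => h ▸ ⟨rfl, rfl⟩, fun ⟨h0, h1⟩ => ?_⟩
    rw [← Fin.cons_self_tail y, h0, h1, Fin.cons_self_tail]
  rw [Fintype.sum_prod_type_right]
  simp only [h]
  rw [Fintype.sum_prod_type]
  simp only [Finset.sum_const, Finset.card_univ, ZMod.card, ← Finset.smul_sum, ← Finset.sum_mul,
    sum_hadamard_cols, hy]
  by_cases h1 : y 0 = y' 0 <;> by_cases h2 : Fin.tail y = Fin.tail y' <;> simp [h1, h2]
  ring

/-- For fixed `b`, the lower and upper Hadamard factors differ by a sign that depends on the column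
and not on `t`. After summation over the first component of the row, `t` survives only in the factor
`bitSign t`, and the two values of `t` cancel. -/
lemma sum_lowerSign_upperSign_cols (k : ℕ) (y : SignCol k) (y' : SignCol (k + 1)) :
    ∑ g, lowerSign k g y * upperSign k g y' = 0 := by
  have h : ∀ (b : BitVec4) (t : ZMod 2),
      ∑ x : SignCol k, lowerSign k (x, b, t) y * upperSign k (x, b, t) y' =
        bitSign t * (hadamard (rowCode 0 none) b (y' 0) *
          ∏ i, bitSign (quadForm (rowCode 0 (some b)) (y i)) *
            if y i = y' i.succ then 16 else 0) := fun b t => by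
    have hM : ∀ x z : BitVec4, hadamard (rowCode t (some b)) x z =
        bitSign (quadForm (rowCode 0 (some b)) z) * hadamard (rowCode t none) x z := fun x z => by
      rw [hadamard, hadamard, ← bitSign_add]
      simp only [quadForm, rowCode]
      simp
      ring_nf
    have : ∀ x : SignCol k, lowerSign k (x, b, t) y * upperSign k (x, b, t) y' =
        (bitSign t * hadamard (rowCode 0 none) b (y' 0)) *
        ∏ i, bitSign (quadForm (rowCode 0 (some b)) (y i)) *
          (hadamard (rowCode t none) (x i) (y i) * hadamard (rowCode t none) (x i) (y' i.succ)) := fun x => by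
      rw [lowerSign, upperSign]
      simp only [hM, Finset.prod_mul_distrib]
      ring
    simp only [this]
    rw [← Finset.mul_sum, sum_pi_prod (fun i z =>
      bitSign (quadForm (rowCode 0 (some b)) (y i)) * (hadamard (rowCode t none) z (y i) *
          hadamard (rowCode t none) z (y' i.succ)))]
    simp only [← Finset.mul_sum, sum_hadamard_cols]
    ring
  have hs : ∑ t : ZMod 2, bitSign t = 0 := by
    have : ∑ t : ZMod 2, bitSign t = bitSign 0 + bitSign 1 := Fin.sum_univ_two bitSign
    rw [this]; simp [bitSign]
  rw [Fintype.sum_prod_type_right]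
  simp only [h]
  rw [Fintype.sum_prod_type]
  simp only [← Finset.sum_mul, hs, zero_mul, Finset.sum_const_zero]

lemma abs_prod_le_pow {k : ℕ} (f : Fin k → ℝ) {r : ℝ} (h : ∀ i, |f i| ≤ r) :
    |∏ i, f i| ≤ r ^ k := by
  rw [Finset.abs_prod]
  calc ∏ i, |f i| ≤ ∏ _i : Fin k, r := Finset.prod_le_prod (fun i _ => abs_nonneg _) fun i _ => h i
    _ = r ^ k := by simp

lemma sum_lowerSign_rows (k : ℕ) (g h : SignRow k) :
    ∑ y, lowerSign k g y * lowerSign k h y = bitSign g.2.2 * bitSign h.2.2 *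
      ∏ i, ∑ z, hadamard (rowCode g.2.2 (some g.2.1)) (g.1 i) z *
        hadamard (rowCode h.2.2 (some h.2.1)) (h.1 i) z := by
  rw [← sum_pi_prod (fun i z => hadamard (rowCode g.2.2 (some g.2.1)) (g.1 i) z *
        hadamard (rowCode h.2.2 (some h.2.1)) (h.1 i) z), Finset.mul_sum]
  refine Finset.sum_congr rfl fun y _ => ?_
  rw [Finset.prod_mul_distrib, lowerSign, lowerSign]
  ring

lemma abs_sum_lowerSign_rows_le (k : ℕ) {g h : SignRow k} (hgh : g ≠ h) :
    |∑ y, lowerSign k g y * lowerSign k h y| ≤ 15 ^ k := by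
  rw [sum_lowerSign_rows, abs_mul, abs_mul, abs_bitSign, abs_bitSign, one_mul, one_mul]
  obtain ⟨x, b, t⟩ := g
  obtain ⟨x', b', t'⟩ := h
  -- Equal codes force equal `b` and `t`, so the first components differ and some factor vanishes.
  -- Different codes bound every factor by 15.
  by_cases hc : rowCode t (some b) = rowCode t' (some b')
  · obtain ⟨rfl, rfl⟩ := rowCode_some_injective hc
    simp only [sum_hadamard_rows]
    rw [prod_ite_eq_funext, if_neg (fun e => hgh (by rw [e]))]
    simp
  · exact abs_prod_le_pow _ fun i => abs_sum_hadamard_le hc _ _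

lemma sum_upperSign_rows (k : ℕ) (g h : SignRow k) :
    ∑ y, upperSign k g y * upperSign k h y =
      (∑ z, hadamard (rowCode 0 none) g.2.1 z * hadamard (rowCode 0 none) h.2.1 z) *
      ∏ i, ∑ z, hadamard (rowCode g.2.2 none) (g.1 i) z *
        hadamard (rowCode h.2.2 none) (h.1 i) z := by
  rw [← sum_cons_prod]
  refine Finset.sum_congr rfl fun y _ => ?_
  rw [Finset.prod_mul_distrib, upperSign, upperSign]
  ring

lemma abs_sum_upperSign_rows_le (k : ℕ) {g h : SignRow k} (hgh : g ≠ h) :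
    |∑ y, upperSign k g y * upperSign k h y| ≤ 16 * 15 ^ k := by
  rw [sum_upperSign_rows, abs_mul, sum_hadamard_rows]
  obtain ⟨x, b, t⟩ := g
  obtain ⟨x', b', t'⟩ := h
  by_cases hb : b = b'
  · subst hb
    rw [if_pos rfl, abs_of_nonneg (by norm_num : (0 : ℝ) ≤ 16)]
    gcongr
    by_cases hc : rowCode t none = rowCode t' none
    · obtain rfl := rowCode_none_injective hc
      simp only [sum_hadamard_rows]
      rw [prod_ite_eq_funext, if_neg (fun e => hgh (by rw [e]))]
      simp
    · exact abs_prod_le_pow _ fun i => abs_sum_hadamard_le hc _ _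
  · rw [if_neg hb]
    simp

/-- The marker bit makes the two codes differ in every one of the `k + 1` factors, so no factor can
reach 16. -/
lemma abs_sum_upperSign_lowerSign_rows_le (k : ℕ) (g : SignRow k) (h : SignRow (k + 1)) :
    |∑ y, upperSign k g y * lowerSign (k + 1) h y| ≤ 15 ^ (k + 1) := by
  have : ∑ y, upperSign k g y * lowerSign (k + 1) h y = bitSign h.2.2 *
      ((∑ z, hadamard (rowCode 0 none) g.2.1 z *
        hadamard (rowCode h.2.2 (some h.2.1)) (h.1 0) z) *
      ∏ i : Fin k, ∑ z, hadamard (rowCode g.2.2 none) (g.1 i) z *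
        hadamard (rowCode h.2.2 (some h.2.1)) (h.1 i.succ) z) := by
    rw [← sum_cons_prod, Finset.mul_sum]
    refine Finset.sum_congr rfl fun y _ => ?_
    rw [Finset.prod_mul_distrib, upperSign, lowerSign, Fin.prod_univ_succ]
    ring
  rw [this, abs_mul, abs_bitSign, one_mul, abs_mul, pow_succ']
  exact mul_le_mul (abs_sum_hadamard_le (rowCode_none_ne_some _ _ _) _ _)
    (abs_prod_le_pow _ fun i => abs_sum_hadamard_le (rowCode_none_ne_some _ _ _) _ _)
    (abs_nonneg _) (by norm_num)

/-! ### The coefficient space and its norms -/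

section CoefSpace

variable (𝕜 : Type u) [RCLike 𝕜]

/-- The families of coefficients, one for every column of the sign matrices, in which only
finitely many levels are nonzero. -/
def finiteLevels : Submodule 𝕜 (∀ k, SignCol k → 𝕜) where
  carrier := {c | ∃ n, ∀ k, n < k → c k = 0}
  zero_mem' := ⟨0, fun _ _ => rfl⟩
  add_mem' := by
    rintro a b ⟨n, hn⟩ ⟨m, hm⟩
    refine ⟨max n m, fun k hk => ?_⟩
    rw [Pi.add_apply, hn k (lt_of_le_of_lt (le_max_left _ _) hk),
      hm k (lt_of_le_of_lt (le_max_right _ _) hk), add_zero]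
  smul_mem' := by
    rintro r a ⟨n, hn⟩
    exact ⟨n, fun k hk => by rw [Pi.smul_apply, hn k hk, smul_zero]⟩

/-- The coefficient families, to be normed by a weighted supremum over the rows of the sign
matrices; the weight of level `l` is `(1 + s) ^ l`. -/
def CoefSpace (_s : ℝ≥0) : Type u := finiteLevels 𝕜

variable {𝕜} {s s' : ℝ≥0}

instance : AddCommGroup (CoefSpace 𝕜 s) := inferInstanceAs (AddCommGroup (finiteLevels 𝕜))
instance : Module 𝕜 (CoefSpace 𝕜 s) := inferInstanceAs (Module 𝕜 (finiteLevels 𝕜))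

namespace CoefSpace

/-- The coefficients of level `k`. -/
def level (k : ℕ) : CoefSpace 𝕜 s →ₗ[𝕜] (SignCol k → 𝕜) :=
  (LinearMap.proj k : (∀ k, SignCol k → 𝕜) →ₗ[𝕜] _) ∘ₗ (finiteLevels 𝕜).subtype

lemma ext_level {c d : CoefSpace 𝕜 s} (h : ∀ k, level k c = level k d) : c = d :=
  Subtype.ext (funext h)

lemma exists_level_eq_zero (c : CoefSpace 𝕜 s) : ∃ n, ∀ k, n < k → level k c = 0 := c.2

/-- The value of a coefficient family at a row of the sign matrices. -/
def evalAt (l : ℕ) (g : SignRow l) : CoefSpace 𝕜 s →ₗ[𝕜] 𝕜 where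
  toFun c := ∑ y, (lowerSign l g y : 𝕜) * level l c y +
    ∑ y, (upperSign l g y : 𝕜) * level (l + 1) c y
  map_add' c d := by
    simp only [map_add, Pi.add_apply, mul_add, Finset.sum_add_distrib]; ring
  map_smul' r c := by
    simp only [map_smul, Pi.smul_apply, smul_eq_mul, RingHom.id_apply, mul_add, Finset.mul_sum]
    congr 1 <;> exact Finset.sum_congr rfl fun y _ => by ring

lemma evalAt_apply (l : ℕ) (g : SignRow l) (c : CoefSpace 𝕜 s) :
    evalAt l g c = ∑ y, (lowerSign l g y : 𝕜) * level l c y +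
      ∑ y, (upperSign l g y : 𝕜) * level (l + 1) c y := rfl

lemma sum_lowerSign_mul_evalAt (l : ℕ) (y : SignCol l) (c : CoefSpace 𝕜 s) :
    ∑ g, (lowerSign l g y : 𝕜) * evalAt l g c = 32 * 16 ^ l * level l c y := by
  have h1 : ∀ y', ∑ g, (lowerSign l g y : 𝕜) * (lowerSign l g y' : 𝕜) =
      if y = y' then 32 * 16 ^ l else 0 := fun y' => by
    have := congrArg (RCLike.ofReal (K := 𝕜)) (sum_lowerSign_cols l y y')
    push_cast at this
    rw [this]; split_ifs <;> push_cast <;> rfl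
  have h2 : ∀ y', ∑ g, (lowerSign l g y : 𝕜) * (upperSign l g y' : 𝕜) = 0 := fun y' => by
    have := congrArg (RCLike.ofReal (K := 𝕜)) (sum_lowerSign_upperSign_cols l y y')
    push_cast at this
    simpa using this
  simp only [evalAt_apply, mul_add, Finset.sum_add_distrib, Finset.mul_sum, ← mul_assoc]
  rw [Finset.sum_comm, Finset.sum_comm (s := Finset.univ (α := SignRow l))]
  simp only [← Finset.sum_mul, h1, h2]
  simp

/-- Together with `sum_lowerSign_mul_evalAt` this reads the same coefficients from rows of two
adjacent levels, which is what makes the traces telescope. -/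
lemma sum_upperSign_mul_evalAt (l : ℕ) (y : SignCol (l + 1)) (c : CoefSpace 𝕜 s) :
    ∑ g, (upperSign l g y : 𝕜) * evalAt l g c = 32 * 16 ^ l * level (l + 1) c y := by
  have h1 : ∀ y', ∑ g, (upperSign l g y : 𝕜) * (upperSign l g y' : 𝕜) =
      if y = y' then 32 * 16 ^ l else 0 := fun y' => by
    have := congrArg (RCLike.ofReal (K := 𝕜)) (sum_upperSign_cols l y y')
    push_cast at this
    rw [this]; split_ifs <;> push_cast <;> rfl
  have h2 : ∀ y', ∑ g, (upperSign l g y : 𝕜) * (lowerSign l g y' : 𝕜) = 0 := fun y' => by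
    have := congrArg (RCLike.ofReal (K := 𝕜)) (sum_lowerSign_upperSign_cols l y' y)
    push_cast at this
    simpa [mul_comm] using this
  simp only [evalAt_apply, mul_add, Finset.sum_add_distrib, Finset.mul_sum, ← mul_assoc]
  rw [Finset.sum_comm, Finset.sum_comm (s := Finset.univ (α := SignRow l))]
  simp only [← Finset.sum_mul, h1, h2]
  simp

variable (𝕜 s) in
/-- The weighted values of a coefficient family, as a bounded function on the rows. -/
def toBounded : CoefSpace 𝕜 s →ₗ[𝕜] lp (fun _ : Σ l, SignRow l => 𝕜) ∞ where
  toFun c := ⟨fun i => (((1 + s : ℝ) ^ i.1 : ℝ) : 𝕜) * evalAt i.1 i.2 c, by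
    obtain ⟨n, hn⟩ := c.exists_level_eq_zero
    change Memℓp (E := fun _ : Σ l, SignRow l => 𝕜) _ ∞
    refine (memℓp_zero ?_).of_exponent_ge zero_le
    refine ((Finset.range (n + 1)).sigma fun _ => Finset.univ).finite_toSet.subset fun i hi => ?_
    simp only [Finset.coe_sigma, Set.mem_sigma_iff, Finset.coe_range, Set.mem_Iio,
      Finset.coe_univ, Set.mem_univ, and_true]
    by_contra! h
    apply hi
    rw [evalAt_apply, hn _ (by omega), hn _ (by omega)]
    simp⟩
  map_add' c d := by
    refine lp.ext (funext fun i => ?_)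
    exact (congrArg _ (map_add (evalAt i.1 i.2) c d)).trans (mul_add _ _ _)
  map_smul' r c := by
    refine lp.ext (funext fun i => ?_)
    exact (congrArg _ (map_smul (evalAt i.1 i.2) r c)).trans (mul_left_comm _ _ _)

lemma toBounded_apply (c : CoefSpace 𝕜 s) (i : Σ l, SignRow l) :
    toBounded 𝕜 s c i = (((1 + s : ℝ) ^ i.1 : ℝ) : 𝕜) * evalAt i.1 i.2 c := rfl

lemma norm_weight (l : ℕ) : ‖(((1 + s : ℝ) ^ l : ℝ) : 𝕜)‖ = (1 + s : ℝ) ^ l := by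
  rw [RCLike.norm_ofReal, abs_of_nonneg (by positivity)]

lemma toBounded_injective : Function.Injective (toBounded 𝕜 s) := by
  rw [← LinearMap.ker_eq_bot, LinearMap.ker_eq_bot']
  intro c hc
  have h : ∀ l g, evalAt l g c = 0 := fun l g => by
    have h1 : toBounded 𝕜 s c ⟨l, g⟩ = 0 := by rw [hc]; rfl
    rw [toBounded_apply] at h1
    refine (mul_eq_zero.1 h1).resolve_left fun h0 => ?_
    have := norm_weight (𝕜 := 𝕜) (s := s) l
    rw [h0, norm_zero] at this
    exact (show (0 : ℝ) < (1 + s) ^ l by positivity).ne this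
  refine ext_level fun k => funext fun y => ?_
  have h1 := sum_lowerSign_mul_evalAt k y c
  simp only [h, mul_zero, Finset.sum_const_zero] at h1
  simpa using h1.symm

instance : NormedAddCommGroup (CoefSpace 𝕜 s) :=
  NormedAddCommGroup.induced _ _ (toBounded 𝕜 s) toBounded_injective

instance : NormedSpace 𝕜 (CoefSpace 𝕜 s) := NormedSpace.induced 𝕜 _ _ (toBounded 𝕜 s)

variable (𝕜 s) in
/-- The isometric embedding of the coefficient space into the bounded functions on the rows. -/
def toBoundedₗᵢ : CoefSpace 𝕜 s →ₗᵢ[𝕜] lp (fun _ : Σ l, SignRow l => 𝕜) ∞ where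
  toLinearMap := toBounded 𝕜 s
  norm_map' _ := rfl

lemma weight_mul_norm_evalAt_le (l : ℕ) (g : SignRow l) (c : CoefSpace 𝕜 s) :
    (1 + s : ℝ) ^ l * ‖evalAt l g c‖ ≤ ‖c‖ := by
  have := lp.norm_apply_le_norm ENNReal.top_ne_zero (toBounded 𝕜 s c) ⟨l, g⟩
  rwa [toBounded_apply, norm_mul, norm_weight] at this

lemma norm_le_of_forall {c : CoefSpace 𝕜 s} {C : ℝ} (hC : 0 ≤ C)
    (h : ∀ l g, (1 + s : ℝ) ^ l * ‖evalAt l g c‖ ≤ C) : ‖c‖ ≤ C := by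
  refine lp.norm_le_of_forall_le (f := toBounded 𝕜 s c) hC fun i => ?_
  rw [toBounded_apply, norm_mul, norm_weight]
  exact h i.1 i.2

lemma norm_evalAt_le (l : ℕ) (g : SignRow l) (c : CoefSpace 𝕜 s) :
    ‖evalAt l g c‖ ≤ ‖c‖ := by
  refine le_trans ?_ (weight_mul_norm_evalAt_le l g c)
  exact le_mul_of_one_le_left (norm_nonneg _) (one_le_pow₀ (by simp))

variable (𝕜 s) in
/-- Evaluation at a row as a bounded functional. -/
def evalDual (l : ℕ) (g : SignRow l) : StrongDual 𝕜 (CoefSpace 𝕜 s) :=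
  (evalAt l g).mkContinuous 1 fun c => by rw [one_mul]; exact norm_evalAt_le l g c

lemma evalDual_apply (l : ℕ) (g : SignRow l) (c : CoefSpace 𝕜 s) :
    evalDual 𝕜 s l g c = evalAt l g c := rfl

lemma norm_evalDual_le (l : ℕ) (g : SignRow l) : ‖evalDual 𝕜 s l g‖ ≤ 1 :=
  LinearMap.mkContinuous_norm_le _ zero_le_one _

variable (𝕜 s) in
/-- The coefficient functionals. -/
def coefDual (l : ℕ) (y : SignCol l) : StrongDual 𝕜 (CoefSpace 𝕜 s) :=
  (32 * 16 ^ l : 𝕜)⁻¹ • ∑ g, (lowerSign l g y : 𝕜) • evalDual 𝕜 s l g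

lemma rowCount_ne_zero (l : ℕ) : (32 * 16 ^ l : 𝕜) ≠ 0 := by
  simp

lemma coefDual_apply (l : ℕ) (y : SignCol l) (c : CoefSpace 𝕜 s) :
    coefDual 𝕜 s l y c = level l c y := by
  simp only [coefDual, FunLike.coe_smul, Pi.smul_apply, FunLike.coe_sum, Finset.sum_apply,
    evalDual_apply, smul_eq_mul, sum_lowerSign_mul_evalAt]
  rw [inv_mul_cancel_left₀ (rowCount_ne_zero l)]

lemma coefDual_succ (l : ℕ) (y : SignCol (l + 1)) :
    coefDual 𝕜 s (l + 1) y =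
      (32 * 16 ^ l : 𝕜)⁻¹ • ∑ g, (upperSign l g y : 𝕜) • evalDual 𝕜 s l g := by
  ext c
  rw [coefDual_apply]
  simp only [FunLike.coe_smul, Pi.smul_apply, FunLike.coe_sum, Finset.sum_apply,
    evalDual_apply, smul_eq_mul, sum_upperSign_mul_evalAt]
  rw [inv_mul_cancel_left₀ (rowCount_ne_zero l)]

variable (𝕜 s) in
/-- The coefficient families supported in level `k`. -/
def ofLevel (k : ℕ) : (SignCol k → 𝕜) →ₗ[𝕜] CoefSpace 𝕜 s :=
  (LinearMap.single 𝕜 (fun k => SignCol k → 𝕜) k).codRestrict (finiteLevels 𝕜) fun a =>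
    ⟨k, fun l hl => by simp [Pi.single_eq_of_ne hl.ne']⟩

lemma level_ofLevel_same (k : ℕ) (a : SignCol k → 𝕜) : level k (ofLevel 𝕜 s k a) = a :=
  Pi.single_eq_same (M := fun k => SignCol k → 𝕜) k a

lemma level_ofLevel_ne {k l : ℕ} (h : l ≠ k) (a : SignCol k → 𝕜) :
    level l (ofLevel 𝕜 s k a) = 0 :=
  Pi.single_eq_of_ne (M := fun k => SignCol k → 𝕜) h a

lemma evalAt_ofLevel_same (k : ℕ) (g : SignRow k) (a : SignCol k → 𝕜) :
    evalAt k g (ofLevel 𝕜 s k a) = ∑ y, (lowerSign k g y : 𝕜) * a y := by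
  rw [evalAt_apply, level_ofLevel_same, level_ofLevel_ne (by omega)]
  simp

lemma evalAt_ofLevel_succ (k : ℕ) (g : SignRow k) (a : SignCol (k + 1) → 𝕜) :
    evalAt k g (ofLevel 𝕜 s (k + 1) a) = ∑ y, (upperSign k g y : 𝕜) * a y := by
  rw [evalAt_apply, level_ofLevel_same, level_ofLevel_ne (by omega)]
  simp

lemma evalAt_ofLevel_ne {k l : ℕ} (h : l ≠ k) (h' : l + 1 ≠ k) (g : SignRow l)
    (a : SignCol k → 𝕜) : evalAt l g (ofLevel 𝕜 s k a) = 0 := by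
  rw [evalAt_apply, level_ofLevel_ne h, level_ofLevel_ne h']
  simp

variable (𝕜 s) in
/-- The unit vectors of the coefficient space. -/
def unitVec (k : ℕ) (y : SignCol k) : CoefSpace 𝕜 s := ofLevel 𝕜 s k (Pi.single y 1)

lemma norm_unitVec_le (k : ℕ) (y : SignCol k) : ‖unitVec 𝕜 s k y‖ ≤ (1 + s : ℝ) ^ k := by
  have h1 : (1 : ℝ) ≤ 1 + s := by simp
  refine norm_le_of_forall (by positivity) fun l g => ?_
  rcases eq_or_ne l k with rfl | h
  · rw [unitVec, evalAt_ofLevel_same]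
    simp [Pi.single_apply, abs_lowerSign]
  · rcases eq_or_ne (l + 1) k with rfl | h'
    · rw [unitVec, evalAt_ofLevel_succ]
      simp only [Pi.single_apply, mul_ite, mul_one, mul_zero, Finset.sum_ite_eq', Finset.mem_univ,
        if_true, RCLike.norm_ofReal, abs_upperSign]
      exact pow_le_pow_right₀ h1 (Nat.le_succ l)
    · rw [unitVec, evalAt_ofLevel_ne h h', norm_zero, mul_zero]
      positivity

lemma ofLevel_eq_sum (k : ℕ) (a : SignCol k → 𝕜) :
    ofLevel 𝕜 s k a = ∑ y, a y • unitVec 𝕜 s k y := by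
  conv_lhs => rw [pi_eq_sum_univ' a, map_sum]
  refine Finset.sum_congr rfl fun y _ => ?_
  rw [map_smul, unitVec]

variable (𝕜 s) in
/-- The difference of the normalized rows `g` of the two sign matrices of level `k`. -/
def rowDiff (k : ℕ) (g : SignRow k) : CoefSpace 𝕜 s :=
  ofLevel 𝕜 s (k + 1) (fun y => (16 ^ (k + 1) : 𝕜)⁻¹ * (upperSign k g y : 𝕜)) -
    ofLevel 𝕜 s k (fun y => (16 ^ k : 𝕜)⁻¹ * (lowerSign k g y : 𝕜))

/-- Only rows of levels k - 1, k and k + 1 see this vector. At the row `g` itself both normalized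
parts equal 1 and cancel; everywhere else the near orthogonality of rows applies. The weights cost
at most (1 + s)^(k + 1). -/
lemma norm_rowDiff_le (k : ℕ) (g : SignRow k) :
    ‖rowDiff 𝕜 s k g‖ ≤ (1 + s : ℝ) ^ (k + 1) * (2 * (15 / 16) ^ k) := by
  have h1 : (1 : ℝ) ≤ 1 + s := by simp
  have hin : ∀ (n : ℕ) {ι : Type} [Fintype ι] (a b : ι → ℝ),
      ∑ y, (a y : 𝕜) * ((16 ^ n : 𝕜)⁻¹ * (b y : 𝕜)) =
        (((16 ^ n)⁻¹ * ∑ y, b y * a y : ℝ) : 𝕜) := by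
    intro n ι _ a b
    push_cast
    rw [Finset.mul_sum]
    exact Finset.sum_congr rfl fun y _ => by ring
  have hnorm : ∀ (n : ℕ) (r : ℝ), |(16 ^ n : ℝ)⁻¹ * r| = (16 ^ n)⁻¹ * |r| := fun n r => by
    rw [abs_mul, abs_of_nonneg (by positivity)]
  have main : ∀ l h, l ≤ k + 1 → ‖evalAt l h (rowDiff 𝕜 s k g)‖ ≤ 2 * (15 / 16) ^ k := by
    intro l h hl
    rw [rowDiff, map_sub]
    rcases eq_or_ne l (k + 1) with rfl | hl1
    · rw [evalAt_ofLevel_same, evalAt_ofLevel_ne (by omega) (by omega), sub_zero, hin,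
        RCLike.norm_ofReal, hnorm]
      calc (16 ^ (k + 1) : ℝ)⁻¹ * |∑ y, upperSign k g y * lowerSign (k + 1) h y|
          ≤ (16 ^ (k + 1) : ℝ)⁻¹ * 15 ^ (k + 1) := by
            gcongr; exact abs_sum_upperSign_lowerSign_rows_le k g h
        _ = (15 / 16) * (15 / 16) ^ k := by rw [div_pow]; field_simp; ring
        _ ≤ 2 * (15 / 16) ^ k := by gcongr; norm_num
    · rcases eq_or_ne l k with rfl | hlk
      · rw [evalAt_ofLevel_same, evalAt_ofLevel_succ, hin, hin, ← RCLike.ofReal_sub,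
          RCLike.norm_ofReal]
        rcases eq_or_ne g h with rfl | hgh
        · have e1 : ∑ y, upperSign l g y * upperSign l g y = 16 ^ (l + 1) := by
            have : ∀ y, upperSign l g y * upperSign l g y = 1 := fun y => by
              rw [← abs_mul_abs_self, abs_upperSign, one_mul]
            simp [this]
          have e2 : ∑ y, lowerSign l g y * lowerSign l g y = 16 ^ l := by
            have : ∀ y, lowerSign l g y * lowerSign l g y = 1 := fun y => by
              rw [← abs_mul_abs_self, abs_lowerSign, one_mul]
            simp [this]
          rw [e1, e2, inv_mul_cancel₀ (by positivity), inv_mul_cancel₀ (by positivity), sub_self,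
            abs_zero]
          positivity
        · calc |(16 ^ (l + 1) : ℝ)⁻¹ * ∑ y, upperSign l g y * upperSign l h y -
                (16 ^ l)⁻¹ * ∑ y, lowerSign l g y * lowerSign l h y|
              ≤ |(16 ^ (l + 1) : ℝ)⁻¹ * ∑ y, upperSign l g y * upperSign l h y| +
                |(16 ^ l : ℝ)⁻¹ * ∑ y, lowerSign l g y * lowerSign l h y| := abs_sub _ _
            _ ≤ (16 ^ (l + 1) : ℝ)⁻¹ * (16 * 15 ^ l) + (16 ^ l)⁻¹ * 15 ^ l := by
              rw [hnorm, hnorm]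
              gcongr
              · exact abs_sum_upperSign_rows_le l hgh
              · exact abs_sum_lowerSign_rows_le l hgh
            _ = 2 * (15 / 16) ^ l := by rw [div_pow]; field_simp; ring
      · rw [evalAt_ofLevel_ne hl1 (by omega), zero_sub, norm_neg]
        rcases eq_or_ne (l + 1) k with rfl | hlk'
        · rw [evalAt_ofLevel_succ, hin, RCLike.norm_ofReal, hnorm]
          calc (16 ^ (l + 1) : ℝ)⁻¹ * |∑ y, lowerSign (l + 1) g y * upperSign l h y|
              = (16 ^ (l + 1) : ℝ)⁻¹ * |∑ y, upperSign l h y * lowerSign (l + 1) g y| := by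
                simp only [mul_comm]
            _ ≤ (16 ^ (l + 1) : ℝ)⁻¹ * 15 ^ (l + 1) := by
              gcongr; exact abs_sum_upperSign_lowerSign_rows_le l h g
            _ = 1 * (15 / 16) ^ (l + 1) := by rw [div_pow]; field_simp
            _ ≤ 2 * (15 / 16) ^ (l + 1) := by gcongr; norm_num
        · rw [evalAt_ofLevel_ne hlk hlk', norm_zero]
          positivity
  refine norm_le_of_forall (by positivity) fun l h => ?_
  rcases le_or_gt l (k + 1) with hl | hl
  · exact mul_le_mul (pow_le_pow_right₀ h1 hl) (main l h hl) (norm_nonneg _) (by positivity)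
  · rw [rowDiff, map_sub, evalAt_ofLevel_ne (by omega) (by omega),
      evalAt_ofLevel_ne (by omega) (by omega), sub_zero, norm_zero, mul_zero]
    positivity

end CoefSpace

end CoefSpace

/-! ### Averaged traces -/

namespace CoefSpace

variable {𝕜 : Type u} [RCLike 𝕜] {s s' : ℝ≥0}

/-- The normalized trace, over the level `k`, of an operator between the duals of two coefficient
spaces. -/
def levelTrace (k : ℕ)
    (T : StrongDual 𝕜 (CoefSpace 𝕜 s) →L[𝕜] StrongDual 𝕜 (CoefSpace 𝕜 s')) : 𝕜 :=
  (16 ^ k : 𝕜)⁻¹ * ∑ y, T (coefDual 𝕜 s k y) (unitVec 𝕜 s' k y)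

lemma levelTrace_add (k : ℕ)
    (T T' : StrongDual 𝕜 (CoefSpace 𝕜 s) →L[𝕜] StrongDual 𝕜 (CoefSpace 𝕜 s')) :
    levelTrace k (T + T') = levelTrace k T + levelTrace k T' := by
  simp [levelTrace, Finset.sum_add_distrib, mul_add]

lemma levelTrace_smul (k : ℕ) (r : 𝕜)
    (T : StrongDual 𝕜 (CoefSpace 𝕜 s) →L[𝕜] StrongDual 𝕜 (CoefSpace 𝕜 s')) :
    levelTrace k (r • T) = r * levelTrace k T := by
  simp [levelTrace, ← Finset.mul_sum, mul_left_comm]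

/-- The functionals of level k + 1 are expanded through `upperSign`, those of level k through
`lowerSign`. Both expansions use the rows of level k, so after exchanging sums the two traces are
averages over the same functionals. -/
lemma levelTrace_succ_sub (k : ℕ)
    (T : StrongDual 𝕜 (CoefSpace 𝕜 s) →L[𝕜] StrongDual 𝕜 (CoefSpace 𝕜 s')) :
    levelTrace (k + 1) T - levelTrace k T =
      (32 * 16 ^ k : 𝕜)⁻¹ * ∑ g, T (evalDual 𝕜 s k g) (rowDiff 𝕜 s' k g) := by
  have h1 : levelTrace (k + 1) T = (32 * 16 ^ k : 𝕜)⁻¹ * ∑ g, T (evalDual 𝕜 s k g)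
      (ofLevel 𝕜 s' (k + 1) fun y => (16 ^ (k + 1) : 𝕜)⁻¹ * (upperSign k g y : 𝕜)) := by
    simp only [levelTrace, coefDual_succ, ofLevel_eq_sum, map_smul, map_sum,
      FunLike.coe_smul, FunLike.coe_sum, Finset.sum_apply, Pi.smul_apply, smul_eq_mul,
      Finset.mul_sum]
    rw [Finset.sum_comm]
    exact Finset.sum_congr rfl fun g _ => Finset.sum_congr rfl fun y _ => by ring
  have h2 : levelTrace k T = (32 * 16 ^ k : 𝕜)⁻¹ * ∑ g, T (evalDual 𝕜 s k g)
      (ofLevel 𝕜 s' k fun y => (16 ^ k : 𝕜)⁻¹ * (lowerSign k g y : 𝕜)) := by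
    simp only [levelTrace, coefDual, ofLevel_eq_sum, map_smul, map_sum,
      FunLike.coe_smul, FunLike.coe_sum, Finset.sum_apply, Pi.smul_apply, smul_eq_mul,
      Finset.mul_sum]
    rw [Finset.sum_comm]
    exact Finset.sum_congr rfl fun g _ => Finset.sum_congr rfl fun y _ => by ring
  rw [h1, h2, ← mul_sub, ← Finset.sum_sub_distrib]
  simp only [rowDiff, map_sub]

lemma card_signRow (k : ℕ) : Fintype.card (SignRow k) = 32 * 16 ^ k := by
  simp [SignRow, SignCol]; ring

lemma norm_rowCount_inv (k : ℕ) : ‖(32 * 16 ^ k : 𝕜)⁻¹‖ = (32 * 16 ^ k : ℝ)⁻¹ := by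
  simp

lemma norm_average_le {k : ℕ} (f : SignRow k → 𝕜) {C : ℝ} (h : ∀ g, ‖f g‖ ≤ C) :
    ‖(32 * 16 ^ k : 𝕜)⁻¹ * ∑ g, f g‖ ≤ C := by
  rw [norm_mul, norm_rowCount_inv, inv_mul_le_iff₀ (by positivity)]
  refine (norm_sum_le_of_le _ fun g _ => h g).trans_eq ?_
  rw [Finset.sum_const, Finset.card_univ, card_signRow, nsmul_eq_mul]
  push_cast; rfl

lemma norm_coefDual_le (k : ℕ) (y : SignCol k) : ‖coefDual 𝕜 s k y‖ ≤ 1 := by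
  refine ContinuousLinearMap.opNorm_le_bound _ zero_le_one fun c => ?_
  simp only [coefDual, FunLike.coe_smul, Pi.smul_apply, FunLike.coe_sum, Finset.sum_apply,
    smul_eq_mul]
  refine norm_average_le _ fun g => ?_
  rw [norm_mul, RCLike.norm_ofReal, abs_lowerSign]
  gcongr
  exact norm_evalAt_le k g c

lemma norm_levelTrace_succ_sub_le (k : ℕ)
    (T : StrongDual 𝕜 (CoefSpace 𝕜 s) →L[𝕜] StrongDual 𝕜 (CoefSpace 𝕜 s')) :
    ‖levelTrace (k + 1) T - levelTrace k T‖ ≤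
      ‖T‖ * (2 * (1 + s') * ((1 + s') * (15 / 16)) ^ k) := by
  rw [levelTrace_succ_sub]
  refine norm_average_le _ fun g => ?_
  calc ‖T (evalDual 𝕜 s k g) (rowDiff 𝕜 s' k g)‖
      ≤ ‖T (evalDual 𝕜 s k g)‖ * ‖rowDiff 𝕜 s' k g‖ := ContinuousLinearMap.le_opNorm _ _
    _ ≤ (‖T‖ * 1) * ((1 + s' : ℝ) ^ (k + 1) * (2 * (15 / 16) ^ k)) := by
      gcongr
      · exact T.le_opNorm_of_le (norm_evalDual_le k g)
      · exact norm_rowDiff_le k g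
    _ = ‖T‖ * (2 * (1 + s') * ((1 + s') * (15 / 16)) ^ k) := by rw [mul_pow]; ring

/-- The weight parameter for which the level traces are uniformly bounded. -/
def weightParam : ℝ≥0 := 1 / 31

lemma one_add_weightParam : (1 + weightParam : ℝ) = 32 / 31 := by
  simp only [weightParam]; push_cast; norm_num

lemma norm_levelTrace_le (k : ℕ)
    (T : StrongDual 𝕜 (CoefSpace 𝕜 s) →L[𝕜] StrongDual 𝕜 (CoefSpace 𝕜 weightParam)) :
    ‖levelTrace k T‖ ≤ 65 * ‖T‖ := by
  -- The increment at level j is at most (64/31)(30/31)^j times the norm, with ratio 32/31 · 15/16 =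
  -- 30/31. The right-hand side is 1 plus the sum of these bounds for j < k.
  have h : ‖levelTrace k T‖ ≤ ‖T‖ * (65 - 64 * (30 / 31) ^ k) := by
    induction k with
    | zero =>
      have h1 : ∀ y, ‖T (coefDual 𝕜 s 0 y) (unitVec 𝕜 weightParam 0 y)‖ ≤ ‖T‖ * 1 * 1 :=
        fun y => ContinuousLinearMap.le_of_opNorm_le_of_le _
          (T.le_opNorm_of_le (norm_coefDual_le _ _))
          (by simpa using norm_unitVec_le (𝕜 := 𝕜) (s := weightParam) 0 y)
      simp only [levelTrace, pow_zero, inv_one, one_mul, Fintype.sum_unique]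
      exact (h1 _).trans_eq (by ring)
    | succ k ih =>
      have h1 := norm_levelTrace_succ_sub_le k T
      rw [one_add_weightParam] at h1
      calc ‖levelTrace (k + 1) T‖ = ‖levelTrace k T + (levelTrace (k + 1) T - levelTrace k T)‖ := by
            rw [add_sub_cancel]
        _ ≤ ‖levelTrace k T‖ + ‖levelTrace (k + 1) T - levelTrace k T‖ := norm_add_le _ _
        _ ≤ ‖T‖ * (65 - 64 * (30 / 31) ^ k) + ‖T‖ * (2 * (32 / 31) * (32 / 31 * (15 / 16)) ^ k) :=
          add_le_add ih h1
        _ = ‖T‖ * (65 - 64 * (30 / 31) ^ (k + 1)) := by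
          rw [show (32 / 31 * (15 / 16) : ℝ) = 30 / 31 by norm_num]; ring
  refine h.trans ?_
  have : (0 : ℝ) ≤ (30 / 31) ^ k := by positivity
  nlinarith [norm_nonneg T]

lemma sum_norm_sq_lowerSign (k : ℕ) (a : SignCol k → 𝕜) :
    ∑ g, ‖∑ y, (lowerSign k g y : 𝕜) * a y‖ ^ 2 = 32 * 16 ^ k * ∑ y, ‖a y‖ ^ 2 := by
  have h1 : ∀ y y', ∑ g, (lowerSign k g y : 𝕜) * (lowerSign k g y' : 𝕜) =
      if y = y' then 32 * 16 ^ k else 0 := fun y y' => by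
    have := congrArg (RCLike.ofReal (K := 𝕜)) (sum_lowerSign_cols k y y')
    push_cast at this
    rw [this]; split_ifs <;> push_cast <;> rfl
  have h2 : ∀ g, ((‖∑ y, (lowerSign k g y : 𝕜) * a y‖ ^ 2 : ℝ) : 𝕜) =
      ∑ y, ∑ y', (lowerSign k g y : 𝕜) * (lowerSign k g y' : 𝕜) * (a y * conj (a y')) :=
    fun g => by
    push_cast
    rw [← RCLike.mul_conj, map_sum, Finset.sum_mul_sum]
    refine Finset.sum_congr rfl fun y _ => Finset.sum_congr rfl fun y' _ => ?_
    rw [map_mul, RCLike.conj_ofReal]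
    ring
  apply RCLike.ofReal_injective (K := 𝕜)
  rw [RCLike.ofReal_sum]
  simp only [h2]
  rw [Finset.sum_comm]
  simp only [Finset.sum_comm (s := Finset.univ (α := SignRow k)), ← Finset.sum_mul, h1]
  simp only [ite_mul, zero_mul, Finset.sum_ite_eq, Finset.mem_univ, if_true, RCLike.mul_conj]
  push_cast
  rw [Finset.mul_sum]

/-- By duality it is enough to bound a combination of coefficient functionals by the Euclidean norm
of its coefficients. Such a combination is an average of row evaluations, so Cauchy–Schwarz and the
Parseval identity `sum_norm_sq_lowerSign` give this. -/
lemma sum_norm_sq_coefDual_le (k : ℕ) (f : StrongDual 𝕜 (StrongDual 𝕜 (CoefSpace 𝕜 s))) :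
    ∑ y, ‖f (coefDual 𝕜 s k y)‖ ^ 2 ≤ ‖f‖ ^ 2 := by
  set A : ℝ := ∑ y, ‖f (coefDual 𝕜 s k y)‖ ^ 2 with hA
  have hA0 : 0 ≤ A := Finset.sum_nonneg fun _ _ => sq_nonneg _
  set a : SignCol k → 𝕜 := fun y => conj (f (coefDual 𝕜 s k y))
  set ψ : StrongDual 𝕜 (CoefSpace 𝕜 s) := ∑ y, a y • coefDual 𝕜 s k y with hψ
  have hfψ : f ψ = (A : 𝕜) := by
    rw [hψ, map_sum, hA]
    push_cast
    refine Finset.sum_congr rfl fun y _ => ?_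
    rw [map_smul, smul_eq_mul, RCLike.conj_mul]
  have hψn : ‖ψ‖ ≤ √A := by
    refine ContinuousLinearMap.opNorm_le_bound _ (Real.sqrt_nonneg _) fun c => ?_
    have e : ψ c = (32 * 16 ^ k : 𝕜)⁻¹ * ∑ g, (∑ y, (lowerSign k g y : 𝕜) * a y) *
        evalAt k g c := by
      simp only [hψ, coefDual, FunLike.coe_smul, FunLike.coe_sum, Finset.sum_apply, Pi.smul_apply,
        smul_eq_mul, evalDual_apply, Finset.mul_sum, Finset.sum_mul]
      rw [Finset.sum_comm]
      exact Finset.sum_congr rfl fun g _ => Finset.sum_congr rfl fun y _ => by ring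
    have hsum : ∑ g, ‖∑ y, (lowerSign k g y : 𝕜) * a y‖ ≤ 32 * 16 ^ k * √A := by
      refine abs_le_of_sq_le_sq' ?_ (by positivity) |>.2
      refine (sq_sum_le_card_mul_sum_sq).trans_eq ?_
      rw [Finset.card_univ, card_signRow, sum_norm_sq_lowerSign, mul_pow, Real.sq_sqrt hA0]
      simp only [a, RCLike.norm_conj, hA]
      push_cast
      ring
    rw [e, norm_mul, norm_rowCount_inv, inv_mul_le_iff₀ (by positivity)]
    calc ‖∑ g, (∑ y, (lowerSign k g y : 𝕜) * a y) * evalAt k g c‖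
        ≤ ∑ g, ‖∑ y, (lowerSign k g y : 𝕜) * a y‖ * ‖c‖ := by
          refine norm_sum_le_of_le _ fun g _ => ?_
          rw [norm_mul]
          gcongr
          exact norm_evalAt_le k g c
      _ = (∑ g, ‖∑ y, (lowerSign k g y : 𝕜) * a y‖) * ‖c‖ := by rw [Finset.sum_mul]
      _ ≤ (32 * 16 ^ k * √A) * ‖c‖ := by gcongr
      _ = 32 * 16 ^ k * (√A * ‖c‖) := by ring
  have h := f.le_opNorm_of_le hψn
  rw [hfψ, RCLike.norm_ofReal, abs_of_nonneg hA0] at h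
  have h' : √A ≤ ‖f‖ := by
    rcases hA0.eq_or_lt with h0 | h0
    · rw [← h0, Real.sqrt_zero]; exact norm_nonneg f
    · have hs : 0 < √A := Real.sqrt_pos.2 h0
      nlinarith [Real.mul_self_sqrt hA0]
  calc A = √A ^ 2 := (Real.sq_sqrt hA0).symm
    _ ≤ ‖f‖ ^ 2 := by gcongr

/-- Cauchy–Schwarz over 16^k columns costs 4^k and the unit vectors cost (32/31)^k. Against the
normalization 16^(-k) this leaves (8/31)^k. -/
lemma tendsto_levelTrace_smulRight (f : StrongDual 𝕜 (StrongDual 𝕜 (CoefSpace 𝕜 s)))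
    (η : StrongDual 𝕜 (CoefSpace 𝕜 weightParam)) :
    Tendsto (fun k => levelTrace k (f.smulRight η)) atTop (𝓝 0) := by
  have hb : ∀ k, ‖levelTrace k (f.smulRight η)‖ ≤ ‖f‖ * ‖η‖ * (8 / 31) ^ k := fun k => by
    have hs : ∑ y, ‖f (coefDual 𝕜 s k y)‖ ≤ 4 ^ k * ‖f‖ := by
      refine abs_le_of_sq_le_sq' ?_ (by positivity) |>.2
      refine (sq_sum_le_card_mul_sum_sq).trans ?_
      have hc : (((Finset.univ : Finset (SignCol k)).card : ℕ) : ℝ) = 16 ^ k := by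
        simp
      rw [hc, mul_pow, ← pow_mul, mul_comm k 2, pow_mul]
      norm_num
      exact sum_norm_sq_coefDual_le k f
    rw [levelTrace, norm_mul, norm_inv, norm_pow]
    rw [inv_mul_le_iff₀ (by simp)]
    calc ‖∑ y, (f.smulRight η) (coefDual 𝕜 s k y) (unitVec 𝕜 weightParam k y)‖
        ≤ ∑ y, ‖f (coefDual 𝕜 s k y)‖ * (‖η‖ * (32 / 31) ^ k) := by
          refine norm_sum_le_of_le _ fun y _ => ?_
          simp only [ContinuousLinearMap.smulRight_apply, FunLike.coe_smul, Pi.smul_apply,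
            smul_eq_mul, norm_mul]
          gcongr
          refine η.le_opNorm_of_le ?_
          rw [← one_add_weightParam]
          exact norm_unitVec_le k y
      _ = (∑ y, ‖f (coefDual 𝕜 s k y)‖) * (‖η‖ * (32 / 31) ^ k) := by rw [Finset.sum_mul]
      _ ≤ 4 ^ k * ‖f‖ * (‖η‖ * (32 / 31) ^ k) := by gcongr
      _ = ‖f‖ * ‖η‖ * (4 * (32 / 31)) ^ k := by rw [mul_pow]; ring
      _ = ‖(16 : 𝕜)‖ ^ k * (‖f‖ * ‖η‖ * (8 / 31) ^ k) := by
        rw [RCLike.norm_ofNat, show (4 * (32 / 31) : ℝ) = 16 * (8 / 31) by norm_num, mul_pow]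
        ring
  refine squeeze_zero_norm hb ?_
  have := (tendsto_pow_atTop_nhds_zero_of_lt_one (r := (8 / 31 : ℝ)) (by norm_num)
    (by norm_num)).const_mul (‖f‖ * ‖η‖)
  simpa using this

/-- A bounded finite rank operator is a finite sum of rank one operators. -/
lemma _root_.exists_eq_sum_smulRight_of_mem_finiteRankOperators {X : Type v} {Y : Type w}
    [NormedAddCommGroup X] [NormedSpace 𝕜 X] [NormedAddCommGroup Y] [NormedSpace 𝕜 Y]
    {T : X →L[𝕜] Y} (hT : T ∈ finiteRankOperators 𝕜 X Y) :
    ∃ (n : ℕ) (f : Fin n → StrongDual 𝕜 X) (y : Fin n → Y), T = ∑ i, (f i).smulRight (y i) := by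
  have hfin : FiniteDimensional 𝕜 (LinearMap.range (T : X →ₗ[𝕜] Y)) := by
    have h1 : (T : X →ₗ[𝕜] Y) ∈ LinearMap.finiteRange 𝕜 X Y := hT
    rw [LinearMap.mem_finiteRange_iff_hasFiniteRange] at h1
    exact Module.Finite.of_fg h1
  set W := LinearMap.range (T : X →ₗ[𝕜] Y)
  set b := Module.finBasis 𝕜 W
  set T' : X →L[𝕜] W := T.codRestrict W fun x => LinearMap.mem_range_self _ x
  refine ⟨_, fun i => (LinearMap.toContinuousLinearMap (b.coord i)).comp T',
    fun i => (b i : Y), ?_⟩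
  ext x
  have := congrArg (Subtype.val) (b.sum_repr (T' x))
  rw [AddSubmonoidClass.coe_finsetSum] at this
  simp only [FunLike.coe_sum, Finset.sum_apply, ContinuousLinearMap.smulRight_apply]
  exact this.symm

lemma tendsto_levelTrace_of_mem_finiteRankOperators
    {T : StrongDual 𝕜 (CoefSpace 𝕜 s) →L[𝕜] StrongDual 𝕜 (CoefSpace 𝕜 weightParam)}
    (hT : T ∈ finiteRankOperators 𝕜 _ _) :
    Tendsto (fun k => levelTrace k T) atTop (𝓝 0) := by
  obtain ⟨n, f, y, rfl⟩ := exists_eq_sum_smulRight_of_mem_finiteRankOperators hT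
  have h : ∀ k, levelTrace k (∑ i, (f i).smulRight (y i)) =
      ∑ i, levelTrace k ((f i).smulRight (y i)) := fun k => by
    simp only [levelTrace, FunLike.coe_sum, Finset.sum_apply]
    rw [Finset.sum_comm, Finset.mul_sum]
  simp only [h]
  simpa using tendsto_finsetSum Finset.univ fun i _ => tendsto_levelTrace_smulRight (f i) (y i)

end CoefSpace

/-! ### A compact operator with constant level traces -/

section DualMap

variable {𝕜 : Type u} [RCLike 𝕜] {X : Type v} {Y : Type w}
  [NormedAddCommGroup X] [NormedSpace 𝕜 X] [NormedAddCommGroup Y] [NormedSpace 𝕜 Y]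

/-- The adjoint of a bounded operator, acting between the dual spaces. -/
def dualOperator (A : X →L[𝕜] Y) : StrongDual 𝕜 Y →L[𝕜] StrongDual 𝕜 X :=
  (ContinuousLinearMap.compL 𝕜 X Y 𝕜).flip A

lemma dualOperator_apply (A : X →L[𝕜] Y) (φ : StrongDual 𝕜 Y) :
    dualOperator A φ = φ.comp A := rfl

lemma isCompactOperator_dualOperator_smulRight (f : StrongDual 𝕜 X) (y : Y) :
    IsCompactOperator (dualOperator (f.smulRight y)) := by
  have e : dualOperator (f.smulRight y) =
      (ContinuousLinearMap.toSpanSingleton 𝕜 f).comp (ContinuousLinearMap.apply 𝕜 𝕜 y) := by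
    ext φ x
    simp [dualOperator_apply, mul_comm]
  have h : IsCompactOperator (ContinuousLinearMap.apply 𝕜 𝕜 y : StrongDual 𝕜 Y →L[𝕜] 𝕜) :=
    isCompactOperator_of_locallyCompactSpace_dom _
  rw [e]
  exact h.clm_comp (ContinuousLinearMap.toSpanSingleton 𝕜 f)

lemma isCompactOperator_dualOperator_sum {ι : Type*} (t : Finset ι) (f : ι → StrongDual 𝕜 X)
    (y : ι → Y) : IsCompactOperator (dualOperator (∑ i ∈ t, (f i).smulRight (y i))) := by
  have e : dualOperator (∑ i ∈ t, (f i).smulRight (y i)) =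
      ∑ i ∈ t, dualOperator ((f i).smulRight (y i)) :=
    map_sum (ContinuousLinearMap.compL 𝕜 X Y 𝕜).flip _ _
  rw [e]
  exact Submodule.sum_mem (compactOperator (RingHom.id 𝕜) (StrongDual 𝕜 Y) (StrongDual 𝕜 X))
    fun i _ => isCompactOperator_dualOperator_smulRight (f i) (y i)

lemma isCompactOperator_dualOperator_of_tendsto {A : X →L[𝕜] Y} {B : ℕ → X →L[𝕜] Y}
    (hB : Tendsto B atTop (𝓝 A)) (hc : ∀ n, IsCompactOperator (dualOperator (B n))) :
    IsCompactOperator (dualOperator A) :=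
  isCompactOperator_of_tendsto
    (((ContinuousLinearMap.compL 𝕜 X Y 𝕜).flip.continuous.tendsto A).comp hB)
    (Eventually.of_forall hc)

end DualMap

/-- If the restriction of functionals along an isometric embedding followed by `V` is compact,
then `V` is compact. -/
lemma isCompactOperator_of_comp_dualOperator_isometry {𝕜 : Type u} [RCLike 𝕜] {X Z W : Type*}
    [NormedAddCommGroup X] [NormedSpace 𝕜 X] [NormedAddCommGroup Z] [NormedSpace 𝕜 Z]
    [NormedAddCommGroup W] [NormedSpace 𝕜 W] (J : X →ₗᵢ[𝕜] Z) (V : StrongDual 𝕜 X →L[𝕜] W)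
    (h : IsCompactOperator
      (V.comp (dualOperator J.toContinuousLinearMap))) :
    IsCompactOperator V := by
  obtain ⟨K, hK, hsub⟩ := (isCompactOperator_iff_image_closedBall_subset_compact
    ((V.comp (dualOperator J.toContinuousLinearMap)) : StrongDual 𝕜 Z →ₗ[𝕜] W)
    zero_lt_one).1 h
  refine (isCompactOperator_iff_image_closedBall_subset_compact (V : StrongDual 𝕜 X →ₗ[𝕜] W)
    zero_lt_one).2 ⟨K, hK, ?_⟩
  rintro _ ⟨φ, hφ, rfl⟩
  rw [mem_closedBall_zero_iff] at hφ
  -- By Hahn–Banach the unit ball of the dual of `X` is covered by restrictions from the unit ball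
  -- of the dual of `Z`.
  obtain ⟨φ', hφ', hn⟩ := exists_extension_norm_eq (LinearMap.range J.toLinearMap)
    (φ.comp (J.equivRange.symm : LinearMap.range J.toLinearMap →L[𝕜] X))
  have hφ'' : φ'.comp J.toContinuousLinearMap = φ := by
    ext x
    have := hφ' (J.equivRange x)
    simpa using this
  refine hsub ⟨φ', ?_, ?_⟩
  · rw [mem_closedBall_zero_iff, hn]
    refine (ContinuousLinearMap.opNorm_le_bound _ zero_le_one fun x => ?_)
    refine (φ.le_opNorm _).trans ?_
    change ‖φ‖ * ‖J.equivRange.symm x‖ ≤ _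
    rw [LinearIsometryEquiv.norm_map]
    gcongr
  · change V (φ'.comp J.toContinuousLinearMap) = V φ
    rw [hφ'']

namespace CoefSpace

variable {𝕜 : Type u} [RCLike 𝕜] {s : ℝ≥0}

variable (𝕜 s) in
/-- The identity map from the weighted to the unweighted coefficient space. -/
def unweight : CoefSpace 𝕜 s →L[𝕜] CoefSpace 𝕜 0 :=
  LinearMap.mkContinuous
    ((LinearMap.id : finiteLevels 𝕜 →ₗ[𝕜] finiteLevels 𝕜) : CoefSpace 𝕜 s →ₗ[𝕜] CoefSpace 𝕜 0) 1
    fun c => norm_le_of_forall (by positivity) fun l g => by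
      simp only [NNReal.coe_zero, add_zero, one_pow, one_mul]
      exact norm_evalAt_le (s := s) l g c

lemma level_unweight (k : ℕ) (c : CoefSpace 𝕜 s) : level k (unweight 𝕜 s c) = level k c := rfl

lemma evalAt_unweight (l : ℕ) (g : SignRow l) (c : CoefSpace 𝕜 s) :
    evalAt l g (unweight 𝕜 s c) = evalAt l g c := rfl

variable (𝕜 s) in
/-- The adjoint of `unweight`. -/
def unweightDual : StrongDual 𝕜 (CoefSpace 𝕜 0) →L[𝕜] StrongDual 𝕜 (CoefSpace 𝕜 s) :=
  dualOperator (unweight 𝕜 s)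

lemma levelTrace_unweightDual (k : ℕ) : levelTrace k (unweightDual 𝕜 s) = 1 := by
  have h : ∀ y, unweightDual 𝕜 s (coefDual 𝕜 0 k y) (unitVec 𝕜 s k y) = 1 := fun y => by
    change coefDual 𝕜 0 k y (unweight 𝕜 s (unitVec 𝕜 s k y)) = 1
    rw [coefDual_apply, level_unweight, unitVec, level_ofLevel_same, Pi.single_eq_same]
  simp [levelTrace, h]

variable (𝕜 s) in
/-- The truncation of the unweighted values to the levels below `n`. -/
def truncValues (n : ℕ) : CoefSpace 𝕜 s →L[𝕜] lp (fun _ : Σ l, SignRow l => 𝕜) ∞ :=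
  ∑ i ∈ (Finset.range n).sigma fun _ => Finset.univ,
    (evalDual 𝕜 s i.1 i.2).smulRight (lp.single ∞ i 1)

lemma truncValues_apply (n : ℕ) (c : CoefSpace 𝕜 s) (i : Σ l, SignRow l) :
    truncValues 𝕜 s n c i = if i.1 < n then evalAt i.1 i.2 c else 0 := by
  rw [truncValues, FunLike.coe_sum, Finset.sum_apply, lp.coeFn_sum, Finset.sum_apply]
  simp only [ContinuousLinearMap.smulRight_apply, lp.coeFn_smul, Pi.smul_apply, lp.single_apply,
    evalDual_apply, smul_eq_mul]
  split_ifs with hi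
  · rw [Finset.sum_eq_single i]
    · simp
    · intro j _ hj
      rw [Pi.single_eq_of_ne hj.symm, mul_zero]
    · intro h
      exact absurd (by simpa using hi) h
  · refine Finset.sum_eq_zero fun j hj => ?_
    have : i ≠ j := by
      rintro rfl
      exact hi (by simpa using hj)
    rw [Pi.single_eq_of_ne this, mul_zero]

lemma norm_sub_truncValues_le (n : ℕ) :
    ‖(toBoundedₗᵢ 𝕜 0).toContinuousLinearMap.comp (unweight 𝕜 s) - truncValues 𝕜 s n‖ ≤
      ((1 + s : ℝ)⁻¹) ^ n := by
  refine ContinuousLinearMap.opNorm_le_bound _ (by positivity) fun c => ?_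
  refine lp.norm_le_of_forall_le (by positivity) fun i => ?_
  have h0 : (toBoundedₗᵢ 𝕜 0).toContinuousLinearMap.comp (unweight 𝕜 s) c i =
      evalAt i.1 i.2 c := by
    have := toBounded_apply (unweight 𝕜 s c) i
    simp only [evalAt_unweight, NNReal.coe_zero, add_zero, one_pow, RCLike.ofReal_one,
      one_mul] at this
    exact this
  have h1 : (((toBoundedₗᵢ 𝕜 0).toContinuousLinearMap.comp (unweight 𝕜 s) -
      truncValues 𝕜 s n) c) i = evalAt i.1 i.2 c - if i.1 < n then evalAt i.1 i.2 c else 0 :=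
    congrArg₂ (fun a b : 𝕜 => a - b) h0 (truncValues_apply n c i)
  rw [h1]
  split_ifs with hi
  · rw [sub_self, norm_zero]; positivity
  · rw [sub_zero, inv_pow, le_inv_mul_iff₀ (by positivity)]
    refine le_trans ?_ (weight_mul_norm_evalAt_le i.1 i.2 c)
    gcongr
    · simp
    · omega

/-- The truncations approximate `unweight` only after the embedding into the bounded functions,
since truncated values need not come from coefficients. Precomposing the adjoint with restriction
along that embedding does not affect compactness. -/
lemma isCompactOperator_unweightDual (hs : 0 < s) : IsCompactOperator (unweightDual 𝕜 s) := by
  refine isCompactOperator_of_comp_dualOperator_isometry (toBoundedₗᵢ 𝕜 0) _ ?_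
  have e : (unweightDual 𝕜 s).comp
      (dualOperator (toBoundedₗᵢ 𝕜 0).toContinuousLinearMap) =
      dualOperator
        ((toBoundedₗᵢ 𝕜 0).toContinuousLinearMap.comp (unweight 𝕜 s)) := rfl
  rw [e]
  refine isCompactOperator_dualOperator_of_tendsto (B := truncValues 𝕜 s) ?_ fun n =>
    isCompactOperator_dualOperator_sum _ _ _
  rw [tendsto_iff_norm_sub_tendsto_zero]
  refine squeeze_zero (fun n => norm_nonneg _) (fun n => ?_)
      (tendsto_pow_atTop_nhds_zero_of_lt_one (r := (1 + s : ℝ)⁻¹) (by positivity)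
        (inv_lt_one_of_one_lt₀ (by simpa using hs)))
  rw [norm_sub_rev]
  exact norm_sub_truncValues_le n

variable (𝕜 s) in
/-- The coefficient families vanishing above level `n`. -/
def levelsUpTo (n : ℕ) : Submodule 𝕜 (CoefSpace 𝕜 s) where
  carrier := {c | ∀ k, n < k → level k c = 0}
  zero_mem' _ _ := map_zero _
  add_mem' ha hb k hk := by rw [map_add, ha k hk, hb k hk, add_zero]
  smul_mem' r a ha k hk := by rw [map_smul, ha k hk, smul_zero]

lemma levelsUpTo_mono : Monotone (levelsUpTo 𝕜 s) :=
  fun _ _ h _ hc k hk => hc k (lt_of_le_of_lt h hk)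

lemma exists_mem_levelsUpTo (c : CoefSpace 𝕜 s) : ∃ n, c ∈ levelsUpTo 𝕜 s n :=
  c.exists_level_eq_zero

instance (n : ℕ) : FiniteDimensional 𝕜 (levelsUpTo 𝕜 s n) := by
  refine Module.Finite.of_injective
    ((LinearMap.pi fun k : Fin (n + 1) => level (𝕜 := 𝕜) (s := s) k) ∘ₗ
      (levelsUpTo 𝕜 s n).subtype) ?_
  rw [← LinearMap.ker_eq_bot, LinearMap.ker_eq_bot']
  rintro ⟨c, hc⟩ h
  refine Subtype.ext (ext_level fun k => ?_)
  rcases le_or_gt k n with hk | hk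
  · exact congrFun h ⟨k, by omega⟩
  · exact hc k hk

/-- Needed because `BanachMazurDense` only concerns nonzero spaces; level 0 has exactly one column.
-/
instance (n : ℕ) : Nontrivial (levelsUpTo 𝕜 s n) := by
  refine ⟨⟨unitVec 𝕜 s 0 default, fun k hk => level_ofLevel_ne (by omega) _⟩, 0, fun h => ?_⟩
  have h1 := congrArg (fun c : levelsUpTo 𝕜 s n => level 0 (c : CoefSpace 𝕜 s)) h
  simp only [unitVec, level_ofLevel_same] at h1
  have h2 := congrFun h1 default
  simp at h2

end CoefSpace

/-! ### Complemented dual spaces in the dual of Johnson's space -/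

section Ultralimit

variable {𝕜 : Type u} [RCLike 𝕜] {Y : Type v} [NormedAddCommGroup Y] [NormedSpace 𝕜 Y]
  {C : Type w} [NormedAddCommGroup C] [NormedSpace 𝕜 C]

lemma exists_tendsto_hyperfilter_of_norm_le {f : ℕ → 𝕜} {r : ℝ} (h : ∀ n, ‖f n‖ ≤ r) :
    ∃ a : 𝕜, ‖a‖ ≤ r ∧ Tendsto f (hyperfilter ℕ : Filter ℕ) (𝓝 a) := by
  obtain ⟨a, ha, hle⟩ := (isCompact_closedBall (0 : 𝕜) r).ultrafilter_le_nhds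
    ((hyperfilter ℕ).map f) (by
      rw [le_principal_iff]
      exact Ultrafilter.mem_map.2 (Eventually.of_forall fun n => by simpa using h n))
  exact ⟨a, by simpa using ha, hle⟩

/-- Functionals pulled back along uniformly bounded operators, defined on an increasing sequence
of subspaces with union `Y`, converge along an ultrafilter to functionals on `Y`. -/
lemma exists_ultralimit_dualOperator {F : ℕ → Submodule 𝕜 Y} (hmono : Monotone F)
    (hex : ∀ y, ∃ n, y ∈ F n) (J : ∀ n, F n →L[𝕜] C) {K : ℝ} (hK : 0 ≤ K)
    (hJ : ∀ n, ‖J n‖ ≤ K) :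
    ∃ R : StrongDual 𝕜 C →L[𝕜] StrongDual 𝕜 Y, ‖R‖ ≤ K ∧
      ∀ (φ : StrongDual 𝕜 C) (y : Y) (a : 𝕜),
        (∀ n (h : y ∈ F n), φ (J n ⟨y, h⟩) = a) → R φ y = a := by
  classical
  -- The value 0 outside `F n` is harmless: each vector lies in `F n` for all large n, and the
  -- ultrafilter ignores the finitely many others.
  set f : StrongDual 𝕜 C → Y → ℕ → 𝕜 :=
    fun φ y n => if h : y ∈ F n then φ (J n ⟨y, h⟩) else 0 with hf
  have hfe : ∀ φ y n (h : y ∈ F n), f φ y n = φ (J n ⟨y, h⟩) := fun φ y n h => dif_pos h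
  have hbound : ∀ φ y n, ‖f φ y n‖ ≤ K * ‖φ‖ * ‖y‖ := fun φ y n => by
    by_cases h : y ∈ F n
    · rw [hfe φ y n h]
      calc ‖φ (J n ⟨y, h⟩)‖ ≤ ‖φ‖ * ‖J n ⟨y, h⟩‖ := φ.le_opNorm _
        _ ≤ ‖φ‖ * (K * ‖y‖) := by
          gcongr
          exact (J n).le_of_opNorm_le (hJ n) ⟨y, h⟩
        _ = K * ‖φ‖ * ‖y‖ := by ring
    · rw [hf]
      simp only [dif_neg h, norm_zero]
      positivity
  choose L hLn hL using fun φ y => exists_tendsto_hyperfilter_of_norm_le (hbound φ y)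
  have hev : ∀ y, ∀ᶠ n in (hyperfilter ℕ : Filter ℕ), y ∈ F n := fun y => by
    obtain ⟨n, hn⟩ := hex y
    exact Nat.hyperfilter_le_atTop ((eventually_ge_atTop n).mono fun m hm => hmono hm hn)
  have huniq : ∀ φ y (g : ℕ → 𝕜) (a : 𝕜), Tendsto g (hyperfilter ℕ : Filter ℕ) (𝓝 a) →
      (∀ᶠ n in (hyperfilter ℕ : Filter ℕ), f φ y n = g n) → L φ y = a := fun φ y g a hg he =>
    tendsto_nhds_unique (hL φ y) (hg.congr' (he.mono fun n h => h.symm))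
  refine ⟨LinearMap.mkContinuous₂ (LinearMap.mk₂ 𝕜 L ?_ ?_ ?_ ?_) K hLn,
    LinearMap.mkContinuous₂_norm_le _ hK _, fun φ y a h => ?_⟩
  · intro φ φ' y
    refine huniq _ _ _ _ ((hL φ y).add (hL φ' y)) ?_
    filter_upwards [hev y] with n h
    rw [hfe _ _ _ h, hfe _ _ _ h, hfe _ _ _ h]; rfl
  · intro r φ y
    refine huniq _ _ _ _ ((hL φ y).const_smul r) ?_
    filter_upwards [hev y] with n h
    rw [hfe _ _ _ h, hfe _ _ _ h]; rfl
  · intro φ y y'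
    refine huniq _ _ _ _ ((hL φ y).add (hL φ y')) ?_
    filter_upwards [hev y, hev y'] with n h h'
    rw [hfe _ _ _ h, hfe _ _ _ h', hfe _ _ _ ((F n).add_mem h h'), ← map_add, ← map_add]; rfl
  · intro r φ y
    refine huniq _ _ _ _ ((hL φ y).const_smul r) ?_
    filter_upwards [hev y] with n h
    rw [hfe _ _ _ h, hfe _ _ _ ((F n).smul_mem r h), ← map_smul, ← map_smul]; rfl
  · refine huniq φ y (fun _ => a) a tendsto_const_nhds ?_
    filter_upwards [hev y] with n hn
    rw [hfe _ _ _ hn, h n hn]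

end Ultralimit

lemma lp_one_norm_eq_tsum {ι : Type*} {G : ι → Type*} [∀ i, NormedAddCommGroup (G i)]
    (z : lp G 1) : ‖z‖ = ∑' i, ‖z i‖ := by
  rw [lp.norm_eq_tsum_rpow (by simp)]
  simp

section Reindex

variable {𝕜 : Type u} [RCLike 𝕜] {ι κ : Type*} {G : ι → Type v}
  [∀ i, NormedAddCommGroup (G i)] [∀ i, NormedSpace 𝕜 (G i)]

/-- Restriction of an `ℓ¹`-sum to the image of an injective reindexing. -/
lemma exists_lp_one_reindex {m : κ → ι} (hm : Function.Injective m) :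
    ∃ ρ : lp G 1 →L[𝕜] lp (fun t => G (m t)) 1, ∀ z t, ρ z t = z (m t) := by
  have hs : ∀ z : lp G 1, Summable fun i => ‖z i‖ := fun z => by
    simpa using (lp.memℓp z).summable (by simp)
  have hmem : ∀ z : lp G 1, Memℓp (fun t => z (m t)) 1 := fun z =>
    memℓp_gen (by
      simp only [ENNReal.toReal_one, Real.rpow_one]
      exact (hs z).comp_injective hm)
  let ρ : lp G 1 →ₗ[𝕜] lp (fun t => G (m t)) 1 :=
    { toFun := fun z => ⟨fun t => z (m t), hmem z⟩
      map_add' := fun _ _ => rfl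
      map_smul' := fun _ _ => rfl }
  refine ⟨ρ.mkContinuous 1 fun z => ?_, fun _ _ => rfl⟩
  rw [one_mul, lp_one_norm_eq_tsum, lp_one_norm_eq_tsum]
  exact tsum_comp_le_tsum_of_inj (hs z) (fun _ => norm_nonneg _) hm

end Reindex

section Johnson

variable {𝕜 : Type u} [RCLike 𝕜] {E : ℕ → Type v}
  [∀ n, NormedAddCommGroup (E n)] [∀ n, NormedSpace 𝕜 (E n)]

/-- Rescaling puts the whole distortion on the inverse; nontriviality of `W` ensures that the norm
divided by is nonzero. -/
lemma exists_normalized_iso_of_banachMazurDist_lt {V : Type v} {W : Type w}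
    [NormedAddCommGroup V] [NormedSpace 𝕜 V] [NormedAddCommGroup W] [NormedSpace 𝕜 W]
    [Nontrivial W] (h : banachMazurDist 𝕜 V W < 2) :
    ∃ (A : V →L[𝕜] W) (A' : W →L[𝕜] V), (∀ y, A (A' y) = y) ∧ ‖A‖ ≤ 1 ∧ ‖A'‖ ≤ 2 := by
  obtain ⟨T, hT⟩ := iInf_lt_iff.1 h
  have hTlt : ‖(T : V →L[𝕜] W)‖ * ‖(T.symm : W →L[𝕜] V)‖ < 2 := by
    rw [show (2 : ℝ≥0∞) = ENNReal.ofReal 2 by simp] at hT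
    exact (ENNReal.ofReal_lt_ofReal_iff (by norm_num)).1 hT
  have ht : 0 < ‖(T : V →L[𝕜] W)‖ := by
    rw [norm_pos_iff]
    intro h0
    obtain ⟨w, hw⟩ := exists_ne (0 : W)
    apply hw
    rw [← T.apply_symm_apply w]
    exact congrArg (fun S : V →L[𝕜] W => S (T.symm w)) h0
  set t : ℝ := ‖(T : V →L[𝕜] W)‖
  have ht' : (t : 𝕜) ≠ 0 := by exact_mod_cast ht.ne'
  refine ⟨(t : 𝕜)⁻¹ • (T : V →L[𝕜] W), (t : 𝕜) • (T.symm : W →L[𝕜] V), fun y => ?_, ?_, ?_⟩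
  · simp [ht']
  · rw [norm_smul, norm_inv, RCLike.norm_ofReal, abs_of_pos ht]
    exact (inv_mul_cancel₀ ht.ne').le
  · rw [norm_smul, RCLike.norm_ofReal, abs_of_pos ht]
    exact hTlt.le

/-- In a listing that repeats the members of a dense sequence infinitely often, every sequence of
finite-dimensional spaces is found, up to uniform isomorphism, infinitely often and disjointly. -/
lemma exists_disjoint_isos (hE : BanachMazurDense 𝕜 E) {σ : ℕ → ℕ}
    (hσ : ∀ n, {m | σ m = n}.Infinite) (F : ℕ → Type u) [∀ n, NormedAddCommGroup (F n)]
    [∀ n, NormedSpace 𝕜 (F n)] [∀ n, FiniteDimensional 𝕜 (F n)] [∀ n, Nontrivial (F n)] :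
    ∃ (m : ℕ × ℕ → ℕ) (A : ∀ q, E (σ (m q)) →L[𝕜] F q.2) (A' : ∀ q, F q.2 →L[𝕜] E (σ (m q))),
      Function.Injective m ∧ (∀ q y, A q (A' q y) = y) ∧ (∀ q, ‖A q‖ ≤ 1) ∧
        ∀ q, ‖A' q‖ ≤ 2 := by
  choose e he using fun n => hE (F n) 2 (by norm_num)
  -- Through the pairing function each n is requested infinitely often, and a strictly increasing
  -- choice of positions makes the occurrences disjoint.
  obtain ⟨μ, hμ, hσμ⟩ := extraction_forall_of_frequently
    (P := fun t k => σ k = e (Nat.unpair t).2)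
    (fun t => Nat.frequently_atTop_iff_infinite.2 (hσ _))
  have key : ∀ q : ℕ × ℕ, ∃ (A : E (σ (μ (Nat.pair q.1 q.2))) →L[𝕜] F q.2)
      (A' : F q.2 →L[𝕜] E (σ (μ (Nat.pair q.1 q.2)))),
      (∀ y, A (A' y) = y) ∧ ‖A‖ ≤ 1 ∧ ‖A'‖ ≤ 2 := fun q => by
    rw [hσμ, Nat.unpair_pair]
    exact exists_normalized_iso_of_banachMazurDist_lt (he q.2)
  choose A A' h1 h2 h3 using key
  refine ⟨fun q => μ (Nat.pair q.1 q.2), A, A', fun q q' h => ?_, h1, h2, h3⟩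
  have := Nat.pair_eq_pair.1 (hμ.injective h)
  exact Prod.ext this.1 this.2

variable (𝕜) in
/-- The canonical map from the bounded families of functionals to the dual of an `ℓ¹`-sum. -/
def lpOneDual {ι : Type*} (G : ι → Type v) [∀ i, NormedAddCommGroup (G i)]
    [∀ i, NormedSpace 𝕜 (G i)] :
    lp (fun i => StrongDual 𝕜 (G i)) ∞ →L[𝕜] StrongDual 𝕜 (lp G 1) :=
  lp.dualPairing ∞ 1 (K := 1) (fun i => ContinuousLinearMap.id 𝕜 (StrongDual 𝕜 (G i)))
    fun _ => ContinuousLinearMap.norm_id_le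

/-- The dual of Johnson's space contains disjoint, uniformly complemented copies of the dual of
every normed space that is an increasing union of finite-dimensional subspaces. -/
theorem exists_disjoint_complemented_duals (hE : BanachMazurDense 𝕜 E) {σ : ℕ → ℕ}
    (hσ : ∀ n, {m | σ m = n}.Infinite) {Y : Type u} [NormedAddCommGroup Y] [NormedSpace 𝕜 Y]
    {F : ℕ → Submodule 𝕜 Y} [∀ n, FiniteDimensional 𝕜 (F n)] [∀ n, Nontrivial (F n)]
    (hmono : Monotone F) (hex : ∀ y, ∃ n, y ∈ F n) :
    ∃ (B : C₀(ℕ, 𝕜) →ₗ[𝕜] StrongDual 𝕜 Y →L[𝕜] StrongDual 𝕜 (JohnsonC1 E σ)) (K : ℝ)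
      (R : ℕ → StrongDual 𝕜 (JohnsonC1 E σ) →L[𝕜] StrongDual 𝕜 Y),
      (∀ a, ‖B a‖ ≤ K * ‖a‖) ∧ (∀ l, ‖R l‖ ≤ 2) ∧ ∀ l a ψ, R l (B a ψ) = a l • ψ := by
  obtain ⟨m, A, A', hm, hAA', hA, hA'⟩ := exists_disjoint_isos hE hσ fun n => F n
  obtain ⟨ρ, hρ⟩ := exists_lp_one_reindex (𝕜 := 𝕜) (G := fun i => E (σ i)) hm
  have hA1 : ∀ q, ‖(F q.2).subtypeL.comp (A q)‖ ≤ 1 := fun q =>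
    ((F q.2).subtypeL.comp (A q)).opNorm_le_bound zero_le_one fun x =>
      (A q).le_of_opNorm_le (hA q) x
  have hbound : ∀ (a : C₀(ℕ, 𝕜)) (ψ : StrongDual 𝕜 Y) (q : ℕ × ℕ),
      ‖a q.1 • ψ.comp ((F q.2).subtypeL.comp (A q))‖ ≤ ‖a‖ * ‖ψ‖ := fun a ψ q => by
    rw [norm_smul]
    gcongr
    · exact a.toBCF.norm_coe_le_norm q.1
    · refine (ContinuousLinearMap.opNorm_comp_le _ _).trans ?_
      exact mul_le_of_le_one_right (norm_nonneg _) (hA1 q)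
  -- In `q`, the first entry labels the copy and the second the finite-dimensional piece. A
  -- functional is restricted to every piece and scaled by the coefficient of its copy.
  let Θ₀ : C₀(ℕ, 𝕜) →ₗ[𝕜] StrongDual 𝕜 Y →ₗ[𝕜]
      lp (fun q => StrongDual 𝕜 (E (σ (m q)))) ∞ :=
    LinearMap.mk₂ 𝕜 (fun a ψ => ⟨fun q => a q.1 • ψ.comp ((F q.2).subtypeL.comp (A q)),
        memℓp_infty ⟨‖a‖ * ‖ψ‖, by rintro _ ⟨q, rfl⟩; exact hbound a ψ q⟩⟩)
      (fun a a' ψ => lp.ext (funext fun q => add_smul (a q.1) (a' q.1)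
        (ψ.comp ((F q.2).subtypeL.comp (A q)))))
      (fun r a ψ => lp.ext (funext fun q => mul_smul r (a q.1)
        (ψ.comp ((F q.2).subtypeL.comp (A q)))))
      (fun a ψ ψ' => lp.ext (funext fun q => smul_add (a q.1)
        (ψ.comp ((F q.2).subtypeL.comp (A q))) (ψ'.comp ((F q.2).subtypeL.comp (A q)))))
      (fun r a ψ => lp.ext (funext fun q => smul_comm (a q.1) r
        (ψ.comp ((F q.2).subtypeL.comp (A q)))))
  have hΘ₀ : ∀ a ψ, ‖Θ₀ a ψ‖ ≤ ‖a‖ * ‖ψ‖ := fun a ψ =>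
    lp.norm_le_of_forall_le (by positivity) fun q => hbound a ψ q
  let Θ : C₀(ℕ, 𝕜) → StrongDual 𝕜 Y →L[𝕜] lp (fun q => StrongDual 𝕜 (E (σ (m q)))) ∞ :=
    fun a => (Θ₀ a).mkContinuous ‖a‖ (hΘ₀ a)
  have hΘ : ∀ a ψ q, Θ a ψ q = a q.1 • ψ.comp ((F q.2).subtypeL.comp (A q)) := fun _ _ _ => rfl
  let Δ : lp (fun q => StrongDual 𝕜 (E (σ (m q)))) ∞ →L[𝕜] StrongDual 𝕜 (JohnsonC1 E σ) :=
    (dualOperator ρ).comp (lpOneDual 𝕜 fun q => E (σ (m q)))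
  -- For fixed `l` these lift the pieces into the summands of the l-th copy; the ultralimit of their
  -- adjoints is `R l`.
  let J : ∀ l n, F n →L[𝕜] JohnsonC1 E σ := fun l n =>
    (lp.singleContinuousLinearMap 𝕜 (fun i => E (σ i)) 1 (m (l, n))).comp (A' (l, n))
  have hJ : ∀ l n, ‖J l n‖ ≤ 2 := fun l n =>
    (J l n).opNorm_le_bound (by norm_num) fun y => by
      refine (lp.norm_single (E := fun i => E (σ i)) zero_lt_one (m (l, n)) _).trans_le ?_
      exact (A' (l, n)).le_of_opNorm_le (hA' (l, n)) y
  choose R hRn hR using fun l =>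
    exists_ultralimit_dualOperator hmono hex (J l) zero_le_two (hJ l)
  let B : C₀(ℕ, 𝕜) →ₗ[𝕜] StrongDual 𝕜 Y →L[𝕜] StrongDual 𝕜 (JohnsonC1 E σ) :=
    { toFun := fun a => Δ.comp (Θ a)
      map_add' := fun a a' => ContinuousLinearMap.ext fun ψ =>
        (congrArg Δ (LinearMap.map_add₂ Θ₀ a a' ψ)).trans (map_add Δ _ _)
      map_smul' := fun r a => ContinuousLinearMap.ext fun ψ =>
        (congrArg Δ (LinearMap.map_smul₂ Θ₀ r a ψ)).trans (map_smul Δ r _) }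
  have hB : ∀ a, ‖B a‖ ≤ ‖Δ‖ * ‖a‖ := fun a =>
    (ContinuousLinearMap.opNorm_comp_le Δ (Θ a)).trans (mul_le_mul_of_nonneg_left
      (LinearMap.mkContinuous_norm_le _ (norm_nonneg _) _) (norm_nonneg _))
  refine ⟨B, ‖Δ‖, R, hB, hRn, fun l a ψ => ?_⟩
  ext y
  refine hR l _ y _ fun n hy => ?_
  change ∑' q, Θ a ψ q (ρ (J l n ⟨y, hy⟩) q) = a l * ψ y
  -- Injectivity of `m` leaves the lifted vector with a single coordinate, where `A` undoes `A'`.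
  -- The pairing is thus independent of n, as `hR` demands.
  rw [tsum_eq_single (l, n)]
  · rw [hρ, hΘ]
    have : (J l n ⟨y, hy⟩) (m (l, n)) = A' (l, n) ⟨y, hy⟩ :=
      lp.single_apply_self (E := fun i => E (σ i)) 1 (m (l, n)) _
    rw [this]
    change a l * ψ (A (l, n) (A' (l, n) ⟨y, hy⟩)) = _
    rw [hAA']
  · intro q hq
    have : (J l n ⟨y, hy⟩) (m q) = 0 :=
      lp.single_apply_ne (E := fun i => E (σ i)) 1 (m (l, n)) _ fun h => hq (hm h)
    rw [hρ, this, map_zero]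

end Johnson

/-! ### Approximable operators -/

section Approximable

variable {𝕜 : Type u} [RCLike 𝕜]

lemma comp_comp_mem_finiteRankOperators {X X' Y Y' : Type*}
    [NormedAddCommGroup X] [NormedSpace 𝕜 X] [NormedAddCommGroup X'] [NormedSpace 𝕜 X']
    [NormedAddCommGroup Y] [NormedSpace 𝕜 Y] [NormedAddCommGroup Y'] [NormedSpace 𝕜 Y']
    (R : Y →L[𝕜] Y') (I : X' →L[𝕜] X) {T : X →L[𝕜] Y} (hT : T ∈ finiteRankOperators 𝕜 X Y) :
    R.comp (T.comp I) ∈ finiteRankOperators 𝕜 X' Y' := by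
  have h : (T : X →ₗ[𝕜] Y).HasNoetherianRange := hT
  exact (h.comp_right (I : X' →ₗ[𝕜] X)).comp_left (R : Y →ₗ[𝕜] Y')

lemma comp_comp_mem_approximableOperators {X X' Y Y' : Type*}
    [NormedAddCommGroup X] [NormedSpace 𝕜 X] [NormedAddCommGroup X'] [NormedSpace 𝕜 X']
    [NormedAddCommGroup Y] [NormedSpace 𝕜 Y] [NormedAddCommGroup Y'] [NormedSpace 𝕜 Y']
    (R : Y →L[𝕜] Y') (I : X' →L[𝕜] X) {T : X →L[𝕜] Y} (hT : T ∈ approximableOperators 𝕜 X Y) :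
    R.comp (T.comp I) ∈ approximableOperators 𝕜 X' Y' := by
  have hc : Continuous fun T : X →L[𝕜] Y => R.comp (T.comp I) :=
    continuous_const.clm_comp (continuous_id.clm_comp continuous_const)
  exact map_mem_closure (f := fun T : X →L[𝕜] Y => R.comp (T.comp I))
    (t := (finiteRankOperators 𝕜 X' Y' : Set (X' →L[𝕜] Y'))) hc hT
    fun S hS => comp_comp_mem_finiteRankOperators R I hS

namespace CoefSpace

variable {s : ℝ≥0}

lemma tendsto_levelTrace_of_mem_approximableOperators
    {T : StrongDual 𝕜 (CoefSpace 𝕜 s) →L[𝕜] StrongDual 𝕜 (CoefSpace 𝕜 weightParam)}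
    (hT : T ∈ approximableOperators 𝕜 _ _) :
    Tendsto (fun k => levelTrace k T) atTop (𝓝 0) := by
  rw [Metric.tendsto_nhds]
  intro ε hε
  obtain ⟨S, hS, hTS⟩ := Metric.mem_closure_iff.1 hT (ε / 130) (by positivity)
  filter_upwards [Metric.tendsto_nhds.1 (tendsto_levelTrace_of_mem_finiteRankOperators hS)
    (ε / 2) (by positivity)] with k hk
  rw [dist_zero_right] at hk ⊢
  rw [dist_eq_norm] at hTS
  have h1 := norm_levelTrace_le k (T - S)
  have e : levelTrace k T = levelTrace k (T - S) + levelTrace k S :=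
    (congrArg (levelTrace k) (sub_add_cancel T S).symm).trans (levelTrace_add k _ _)
  calc ‖levelTrace k T‖ = ‖levelTrace k (T - S) + levelTrace k S‖ := by rw [e]
    _ ≤ ‖levelTrace k (T - S)‖ + ‖levelTrace k S‖ := norm_add_le _ _
    _ < ε := by linarith

end CoefSpace

end Approximable

/-! ### Approximation property of ℓ¹-sums of finite-dimensional spaces -/

section LpOne

variable {𝕜 : Type u} [RCLike 𝕜] {G : ℕ → Type v} [∀ i, NormedAddCommGroup (G i)]
  [∀ i, NormedSpace 𝕜 (G i)]

variable (𝕜 G) in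
/-- The projection of an `ℓ¹`-sum onto the sum of its first `N` summands. -/
def lpOneTrunc (N : ℕ) : lp G 1 →L[𝕜] lp G 1 :=
  ∑ i ∈ Finset.range N,
    (lp.singleContinuousLinearMap 𝕜 G 1 i).comp (lp.evalCLM 𝕜 G 1 i)

lemma lpOneTrunc_apply (N : ℕ) (z : lp G 1) :
    lpOneTrunc 𝕜 G N z = ∑ i ∈ Finset.range N, lp.single 1 i (z i) := by
  rw [lpOneTrunc, FunLike.coe_sum, Finset.sum_apply]
  rfl

lemma norm_lpOneTrunc_apply_le (N : ℕ) (z : lp G 1) : ‖lpOneTrunc 𝕜 G N z‖ ≤ ‖z‖ := by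
  have h1 := lp.norm_sum_single (p := 1) (by simp) z (Finset.range N)
  have h2 := lp.sum_rpow_le_norm_rpow (p := 1) (by simp) z (Finset.range N)
  simp only [ENNReal.toReal_one, Real.rpow_one] at h1 h2
  rw [lpOneTrunc_apply, h1]
  exact h2

lemma tendsto_lpOneTrunc_apply (z : lp G 1) :
    Tendsto (fun N => lpOneTrunc 𝕜 G N z) atTop (𝓝 z) := by
  simp only [lpOneTrunc_apply]
  exact (lp.hasSum_single ENNReal.one_ne_top z).tendsto_sum_nat

lemma lpOneTrunc_comp_mem_finiteRankOperators [∀ i, FiniteDimensional 𝕜 (G i)] {X : Type w}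
    [NormedAddCommGroup X] [NormedSpace 𝕜 X] (N : ℕ) (T : X →L[𝕜] lp G 1) :
    (lpOneTrunc 𝕜 G N).comp T ∈ finiteRankOperators 𝕜 X (lp G 1) := by
  have h : (lpOneTrunc 𝕜 G N).comp T = ∑ i ∈ Finset.range N,
      (lp.singleContinuousLinearMap 𝕜 G 1 i).comp ((lp.evalCLM 𝕜 G 1 i).comp T) := by
    ext1 x
    simp [lpOneTrunc]
  rw [h]
  refine Submodule.sum_mem _ fun i _ => ?_
  refine LinearMap.HasNoetherianRange.comp_left (u := (((lp.evalCLM 𝕜 G 1 i).comp T : X →L[𝕜] G i) :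
    X →ₗ[𝕜] G i)) ?_ (lp.singleContinuousLinearMap 𝕜 G 1 i : G i →ₗ[𝕜] lp G 1)
  rw [LinearMap.HasNoetherianRange]
  infer_instance

/-- Compact operators into an `ℓ¹`-sum of finite-dimensional spaces are approximable. -/
theorem IsCompactOperator.mem_approximableOperators_lp_one [∀ i, FiniteDimensional 𝕜 (G i)]
    {X : Type w} [NormedAddCommGroup X] [NormedSpace 𝕜 X] {T : X →L[𝕜] lp G 1}
    (hT : IsCompactOperator T) : T ∈ approximableOperators 𝕜 X (lp G 1) := by
  refine Metric.mem_closure_iff.2 fun ε hε => ?_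
  obtain ⟨K, hK, hsub⟩ := IsCompactOperator.image_closedBall_subset_compact
    (f := (T : X →ₗ[𝕜] lp G 1)) hT 1
  obtain ⟨t, ht, hKt⟩ := Metric.totallyBounded_iff.1 hK.totallyBounded (ε / 4) (by positivity)
  have hev : ∀ᶠ N in atTop, ∀ y ∈ t, dist (lpOneTrunc 𝕜 G N y) y < ε / 4 :=
    (Filter.eventually_all_finite ht).2 fun y _ =>
      Metric.tendsto_nhds.1 (tendsto_lpOneTrunc_apply y) _ (by positivity)
  obtain ⟨N, hN⟩ := hev.exists
  refine ⟨_, lpOneTrunc_comp_mem_finiteRankOperators N T, ?_⟩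
  rw [dist_eq_norm]
  refine lt_of_le_of_lt (ContinuousLinearMap.opNorm_le_of_unit_norm (C := 3 * (ε / 4))
    (by positivity) fun x hx => ?_) (by linarith)
  obtain ⟨y, hy, hxy⟩ := Set.mem_iUnion₂.1 (hKt (hsub ⟨x, by simp [hx], rfl⟩))
  have h1 : ‖T x - y‖ < ε / 4 := by simpa [dist_eq_norm] using hxy
  have h2 : ‖lpOneTrunc 𝕜 G N y - y‖ < ε / 4 := by simpa [dist_eq_norm] using hN y hy
  have h3 := norm_lpOneTrunc_apply_le (𝕜 := 𝕜) N (T x - y)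
  -- `T x` is compared with a nearby point `y` of the finite net. Each of the three terms is below
  -- ε/4, the last one by contractivity of the truncation.
  have e : (T - (lpOneTrunc 𝕜 G N).comp T) x =
      (T x - y) - (lpOneTrunc 𝕜 G N y - y) - lpOneTrunc 𝕜 G N (T x - y) := by
    rw [map_sub]
    change T x - lpOneTrunc 𝕜 G N (T x) = _
    abel
  rw [e]
  have h4 := norm_sub_le ((T x - y) - (lpOneTrunc 𝕜 G N y - y)) (lpOneTrunc 𝕜 G N (T x - y))
  have h5 := norm_sub_le (T x - y) (lpOneTrunc 𝕜 G N y - y)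
  linarith

end LpOne

/-! ### Embedding `c₀` into the quotient by the approximable operators -/

section Main

variable {𝕜 : Type u} [RCLike 𝕜]

lemma containsCopyOfC0_of_bounds {X : Type v} [NormedAddCommGroup X] [NormedSpace 𝕜 X]
    (Q : C₀(ℕ, 𝕜) →ₗ[𝕜] X) {C C' : ℝ} (hC : ∀ a, ‖Q a‖ ≤ C * ‖a‖)
    (hC' : ∀ a, ‖a‖ ≤ C' * ‖Q a‖) : ContainsCopyOfC0 𝕜 X := by
  have hinj : Function.Injective Q := by
    rw [← LinearMap.ker_eq_bot, LinearMap.ker_eq_bot']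
    intro a ha
    have := hC' a
    rw [ha, norm_zero, mul_zero] at this
    exact norm_le_zero_iff.1 this
  let e : C₀(ℕ, 𝕜) ≃L[𝕜] LinearMap.range Q :=
    (LinearEquiv.ofInjective Q hinj).toContinuousLinearEquivOfBounds C C' hC fun x => by
      obtain ⟨a, rfl⟩ := (LinearEquiv.ofInjective Q hinj).surjective x
      rw [LinearEquiv.symm_apply_apply]
      exact hC' a
  refine ⟨LinearMap.range Q, ?_, ⟨e⟩⟩
  have : CompleteSpace (LinearMap.range Q) :=
    (completeSpace_congr (e := e.toEquiv) e.isUniformEmbedding).1 inferInstance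
  exact (completeSpace_coe_iff_isComplete.1 this).isClosed

/-- The sequence in `c₀` that is `1` at the origin and `0` elsewhere. -/
lemma exists_zeroAtInfty_apply_zero_eq_one : ∃ a : C₀(ℕ, 𝕜), a 0 = 1 := by
  refine ⟨⟨⟨fun n => if n = 0 then 1 else 0, continuous_of_discreteTopology⟩, ?_⟩, ?_⟩
  swap
  · exact if_pos (rfl : (0 : ℕ) = 0) (e := (0 : 𝕜))
  refine tendsto_const_nhds.congr' ?_
  rw [cocompact_eq_cofinite]
  filter_upwards [(Set.finite_singleton 0).compl_mem_cofinite] with n hn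
  exact (if_neg hn).symm

/-- The coefficient of `unweightDual` in a compression of `V` is controlled by the distance of `V`
to the approximable operators. -/
lemma norm_le_of_sub_mem_approximableOperators {Z : Type v} [NormedAddCommGroup Z]
    [NormedSpace 𝕜 Z] (I : StrongDual 𝕜 (CoefSpace 𝕜 0) →L[𝕜] Z)
    (R : Z →L[𝕜] StrongDual 𝕜 (CoefSpace 𝕜 CoefSpace.weightParam)) (r : 𝕜) {V S : Z →L[𝕜] Z}
    (hV : R.comp (V.comp I) = r • CoefSpace.unweightDual 𝕜 CoefSpace.weightParam)
    (hVS : V - S ∈ approximableOperators 𝕜 Z Z) :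
    ‖r‖ ≤ 65 * (‖R‖ * ‖I‖) * ‖S‖ := by
  have h0 := CoefSpace.tendsto_levelTrace_of_mem_approximableOperators
    (comp_comp_mem_approximableOperators R I hVS)
  -- The traces of the compressed `V` are constantly `r`, while those of the compressed approximable
  -- part tend to 0. Hence the traces of the compressed `S` tend to `r`.
  have e : ∀ k, CoefSpace.levelTrace k (R.comp ((V - S).comp I)) +
      CoefSpace.levelTrace k (R.comp (S.comp I)) = r := fun k => by
    rw [← CoefSpace.levelTrace_add]
    have : R.comp ((V - S).comp I) + R.comp (S.comp I) = R.comp (V.comp I) := by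
      ext; simp
    rw [this, hV, CoefSpace.levelTrace_smul, CoefSpace.levelTrace_unweightDual, mul_one]
  have h1 : Tendsto (fun k => CoefSpace.levelTrace k (R.comp (S.comp I))) atTop (𝓝 r) := by
    have := (tendsto_const_nhds (x := r)).sub h0
    rw [sub_zero] at this
    exact this.congr fun k => by rw [sub_eq_iff_eq_add', e k]
  refine le_of_tendsto h1.norm (Eventually.of_forall fun k => ?_)
  refine (CoefSpace.norm_levelTrace_le k _).trans ?_
  have h2 : ‖R.comp (S.comp I)‖ ≤ ‖R‖ * (‖S‖ * ‖I‖) :=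
    (ContinuousLinearMap.opNorm_comp_le _ _).trans
      (mul_le_mul_of_nonneg_left (ContinuousLinearMap.opNorm_comp_le _ _) (norm_nonneg _))
  calc 65 * ‖R.comp (S.comp I)‖ ≤ 65 * (‖R‖ * (‖S‖ * ‖I‖)) := by gcongr
    _ = 65 * (‖R‖ * ‖I‖) * ‖S‖ := by ring

/-- If `Z` contains complemented copies of the dual of the unweighted coefficient space and,
disjointly, of the duals of weighted ones, then `c₀` embeds into the compact-by-approximable
operators on `Z`. -/
theorem containsCopyOfC0_compactByApproximable {Z : Type v} [NormedAddCommGroup Z]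
    [NormedSpace 𝕜 Z] (I : StrongDual 𝕜 (CoefSpace 𝕜 0) →L[𝕜] Z)
    (P : Z →L[𝕜] StrongDual 𝕜 (CoefSpace 𝕜 0)) (hPI : ∀ ψ, P (I ψ) = ψ)
    (B : C₀(ℕ, 𝕜) →ₗ[𝕜] StrongDual 𝕜 (CoefSpace 𝕜 CoefSpace.weightParam) →L[𝕜] Z) {K : ℝ}
    (hB : ∀ a, ‖B a‖ ≤ K * ‖a‖)
    (R : ℕ → Z →L[𝕜] StrongDual 𝕜 (CoefSpace 𝕜 CoefSpace.weightParam)) {K' : ℝ}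
    (hR : ∀ l, ‖R l‖ ≤ K') (hRB : ∀ l a ψ, R l (B a ψ) = a l • ψ) :
    ContainsCopyOfC0 𝕜 (CompactByApproximable 𝕜 Z) := by
  have hU : IsCompactOperator (CoefSpace.unweightDual 𝕜 CoefSpace.weightParam) :=
    CoefSpace.isCompactOperator_unweightDual (by simp [CoefSpace.weightParam])
  set U := CoefSpace.unweightDual 𝕜 CoefSpace.weightParam
  let Ψ : C₀(ℕ, 𝕜) →ₗ[𝕜] CompactOperators 𝕜 Z :=
    { toFun := fun a => ⟨(B a).comp (U.comp P), (hU.comp_clm P).clm_comp (B a)⟩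
      map_add' := fun a a' => Subtype.ext (by rw [map_add]; rfl)
      map_smul' := fun r a => Subtype.ext (by rw [map_smul]; rfl) }
  have hK' : 0 ≤ K' := (norm_nonneg (R 0)).trans (hR 0)
  set M : ℝ := 65 * (K' * ‖I‖)
  have hM : 0 ≤ M := by positivity
  -- The estimate holds for every representative `S` of the class of `Ψ a`, hence passes to the
  -- quotient norm. Compression by `R l` and `I` isolates the coordinate `a l`.
  have lower : ∀ (a : C₀(ℕ, 𝕜)) (S : CompactOperators 𝕜 Z),
      Ψ a - S ∈ approximableInCompact 𝕜 Z → ‖a‖ ≤ M * ‖S‖ := fun a S hS => by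
    rw [← ZeroAtInftyContinuousMap.norm_toBCF_eq_norm]
    refine (BoundedContinuousFunction.norm_le (by positivity)).2 fun l => ?_
    refine (norm_le_of_sub_mem_approximableOperators I (R l) (a l)
      (V := (B a).comp (U.comp P)) (S := S) ?_ hS).trans ?_
    · ext1 ψ
      change R l (B a (U (P (I ψ)))) = a l • U ψ
      rw [hPI, hRB]
    · refine mul_le_mul_of_nonneg_right ?_ (norm_nonneg _)
      simp only [M]
      gcongr
      exact hR l
  refine containsCopyOfC0_of_bounds ((Submodule.mkQ (approximableInCompact 𝕜 Z)).comp Ψ)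
    (C := K * ‖U.comp P‖) (C' := M) (fun a => ?_) fun a => ?_
  · refine (Submodule.Quotient.norm_mk_le _ (Ψ a)).trans ?_
    calc ‖(B a).comp (U.comp P)‖ ≤ ‖B a‖ * ‖U.comp P‖ := ContinuousLinearMap.opNorm_comp_le _ _
      _ ≤ K * ‖a‖ * ‖U.comp P‖ := by gcongr; exact hB a
      _ = K * ‖U.comp P‖ * ‖a‖ := by ring
  · refine le_of_forall_pos_le_add fun ε hε => ?_
    -- Dividing by `M + 1` avoids a separate case `M = 0`.
    obtain ⟨S, hS, hlt⟩ := Submodule.Quotient.norm_mk_lt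
      (Submodule.Quotient.mk (Ψ a) : CompactByApproximable 𝕜 Z) (ε := ε / (M + 1)) (by positivity)
    refine (lower a S ((Submodule.Quotient.eq _).1 hS.symm)).trans ?_
    have h1 : M * (ε / (M + 1)) ≤ ε := by
      rw [mul_div_assoc', div_le_iff₀ (by positivity)]
      nlinarith
    have h2 := mul_le_mul_of_nonneg_left hlt.le hM
    rw [mul_add] at h2
    exact h2.trans (add_le_add_right h1 _)

end Main

end

theorem mainTheorem6 {𝕜 : Type*} [RCLike 𝕜] (E : ℕ → Type*)
    [∀ n, NormedAddCommGroup (E n)] [∀ n, NormedSpace 𝕜 (E n)]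
    [∀ n, FiniteDimensional 𝕜 (E n)]
    (hE : BanachMazurDense 𝕜 E)
    (σ : ℕ → ℕ) (hσ : ∀ n, {m | σ m = n}.Infinite) :
    ContainsCopyOfC0 𝕜 (CompactByApproximable 𝕜 (StrongDual 𝕜 (JohnsonC1 E σ))) ∧
      Subsingleton (CompactByApproximable 𝕜 (JohnsonC1 E σ)) := by
  refine ⟨?_, ?_⟩
  · obtain ⟨BX, _, RX, -, -, hX⟩ := exists_disjoint_complemented_duals hE hσ
      (CoefSpace.levelsUpTo_mono (𝕜 := 𝕜) (s := 0)) CoefSpace.exists_mem_levelsUpTo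
    obtain ⟨BY, K, RY, hBY, hRY, hY⟩ := exists_disjoint_complemented_duals hE hσ
      (CoefSpace.levelsUpTo_mono (𝕜 := 𝕜) (s := CoefSpace.weightParam))
      CoefSpace.exists_mem_levelsUpTo
    obtain ⟨δ, hδ⟩ := exists_zeroAtInfty_apply_zero_eq_one (𝕜 := 𝕜)
    -- A single unweighted copy is enough: `δ 0 = 1` makes `RX 0` a left inverse of `BX δ`.
    exact containsCopyOfC0_compactByApproximable (BX δ) (RX 0)
      (fun ψ => by rw [hX, hδ, one_smul]) BY hBY RY hRY hY
  · refine Submodule.Quotient.subsingleton_iff.2 (eq_top_iff.2 fun T _ => ?_)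
    exact IsCompactOperator.mem_approximableOperators_lp_one T.2
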